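/- Let $|\cdot|$ be a norm on $\mathbb R^d$ and let $X=(X_j)_{j\in\mathbb Z}$ be a strictly stationary, regularly varying $\mathbb R^d$-valued time series with tail index $\alpha>0$. Let $Y=(Y_j)_{j\in\mathbb Z}$ be its tail process: for all $i\le j$, the law of $x^{-1}(X_i,\dots,X_j)$ conditionally on $|X_0|>x$ converges weakly to the law of $(Y_i,\dots,Y_j)$ as $x\to\infty$. Put $\Theta_j=Y_j/|Y_0|$. Let $\ell_0$ be the space of sequences $x=(x_j)_{j\in\mathbb Z}$ in $\mathbb R^d$ with $x_j\to0$ as $|j|\to\infty$, with the uniform norm $x^*=\sup_j|x_j|$, and let $\tilde\ell_0$ be its quotient by the relation $x\sim y\iff y$ is a shift of $x$. For a sequence $y$ let $A_0(y)=\inf\{j:\sup_{l\le j}|y_l|=\sup_l|y_l|\}$, with $\inf\emptyset=+\infty$, and put $\vartheta=\mathbb P(A_0(Y)=0)$. Let $(r_n)$ be natural numbers and $(u_n)$ real numbers with $r_n\to\infty$, $u_n\to\infty$, and assume the anticlustering condition $DH(r_n,u_n)$: for all $x,y>0$, $$\lim_{k\to\infty}\limsup_{n\to\infty}\mathbb P\Big(\max_{k\le|j|\le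 r_n}|X_j|>u_nx\,\Big|\,|X_0|>u_ny\Big)=0 .$$ Then $Y\in\ell_0$ almost surely, so that the cluster measure $$\nu^*=\int_0^\infty\mathbb E\big[\delta_{r\Theta}\mathbf 1\{A_0(\Theta)=0\}\big]\,\alpha r^{-\alpha-1}\,dr$$ is a well-defined measure on $\ell_0$, and $\nu^*(\{x: x^*\ge\varepsilon\})<\infty$ for every $\varepsilon>0$. Consider the measures on $\ell_0$ $$\nu^*_{n,r_n}=\frac{\mathbb E[\delta_{X_{1,r_n}/u_n}]}{r_n\mathbb P(|X_0|>u_n)},$$ where $X_{1,r_n}=(X_1,\dots,X_{r_n})$ is padded with zeros on both sides. (a) $\nu^*_{n,r_n}$ converges vaguely$^\#$ to $\nu^*$ on $\tilde\ell_0\setminus\{0\}$: the integrals, with respect to the images of these measures in $\tilde\ell_0$, of every bounded continuous function on $\tilde\ell_0$ that vanishes in a neighbourhood of the class of $0$ converge. (b) More precisely, let $\mathcal A$ be the class of bounded measurable shift-invariant functionals $H:\ell_0\to\mathbb R$ with support separated from $0$ (there is $\varepsilon>0$ with $H(x)=0$ whenever $x^*\le\varepsilon$) which are Lipschitz continuous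 for the uniform norm or continuous at $\nu^*$-almost every point. Then for every $H\in\mathcal A$, $$\lim_{n\to\infty}\nu^*_{n,r_n}(H)=\lim_{n\to\infty}\frac{\mathbb E[H(X_{1,r_n}/u_n)]}{r_n\mathbb P(|X_0|>u_n)}=\nu^*(H).$$ (c) In particular, $$\lim_{n\to\infty}\frac{\mathbb P(\max_{1\le j\le r_n}|X_j|>u_n)}{r_n\mathbb P(|X_0|>u_n)}=\vartheta .$$ -/

import Mathlib

open MeasureTheory ProbabilityTheory Filter Topology
open scoped ENNReal ZeroAtInfty BoundedContinuousFunction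

namespace ClusterRV

noncomputable section

/-! ### The space `ℓ₀` and its quotient by shifts

`ℓ₀(E)`, the sequences `ℤ → E` tending to `0` at infinity, with the uniform norm, is
Mathlib's `C₀(ℤ, E)` (every sequence is continuous, and "at infinity" means along `cofinite`). -/

section Sequences

variable {E : Type*} [NormedAddCommGroup E]

/-- `ℓ₀(E)` carries the Borel σ-algebra of the uniform norm. -/
instance : MeasurableSpace C₀(ℤ, E) := borel _

instance : BorelSpace C₀(ℤ, E) := ⟨rfl⟩

/-- A sequence tending to zero at infinity, as an element of `ℓ₀`. -/
def ofTendsto (y : ℤ → E) (h : Tendsto y cofinite (𝓝 0)) : C₀(ℤ, E) where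
  toFun := y
  continuous_toFun := continuous_of_discreteTopology
  zero_at_infty' := by rwa [cocompact_eq_cofinite]

/-- A finite window `(x_i, …, x_j)` padded by zeros on both sides. -/
def window (i j : ℤ) (x : ℤ → E) : C₀(ℤ, E) :=
  ofTendsto (fun l => if i ≤ l ∧ l ≤ j then x l else 0) <| by
    refine tendsto_const_nhds.congr' ?_
    filter_upwards [(Set.finite_Icc i j).compl_mem_cofinite] with l hl
    exact (if_neg hl).symm

open Classical in
/-- A sequence viewed in `ℓ₀` if it belongs to it; other sequences get the value `0`
(below this is used only for random sequences that belong to `ℓ₀` almost surely). -/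
def toEllZero (y : ℤ → E) : C₀(ℤ, E) :=
  if h : Tendsto y cofinite (𝓝 0) then ofTendsto y h else 0

/-- The `k`-th power of the backshift: `(shift k x)_j = x_{j-k}`. -/
def shift (k : ℤ) (x : C₀(ℤ, E)) : C₀(ℤ, E) :=
  ofTendsto (fun j => x (j - k)) <| by
    have hx : Tendsto x cofinite (𝓝 0) := by
      rw [← cocompact_eq_cofinite]; exact x.zero_at_infty'
    exact hx.comp (sub_left_injective (b := k)).tendsto_cofinite

theorem shift_apply (k : ℤ) (x : C₀(ℤ, E)) (j : ℤ) : shift k x j = x (j - k) := rfl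

variable (E) in
/-- `x ∼ y` iff `y` is a shift of `x`. -/
def shiftSetoid : Setoid C₀(ℤ, E) where
  r x y := ∃ k : ℤ, shift k x = y
  iseqv :=
    { refl := fun x => ⟨0, by ext j; simp [shift_apply]⟩
      symm := by
        rintro x y ⟨k, rfl⟩
        exact ⟨-k, by ext j; simp [shift_apply]⟩
      trans := by
        rintro x y z ⟨k, rfl⟩ ⟨l, rfl⟩
        exact ⟨k + l, by ext j; simp only [shift_apply]; congr 1; ring⟩ }

variable (E) in
/-- The space of shift classes, with the quotient topology and the quotient σ-algebra. -/
abbrev ShiftQuotient : Type _ := Quotient (shiftSetoid E)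

/-- The class of a sequence. -/
def shiftClass (x : C₀(ℤ, E)) : ShiftQuotient E := Quotient.mk (shiftSetoid E) x

/-- Vague# convergence on the shift quotient with the class of zero removed: convergence of
integrals of all bounded continuous functions whose support is bounded away from that class. -/
def VagueSharpTendsto (μ : ℕ → Measure (ShiftQuotient E)) (ν : Measure (ShiftQuotient E)) :
    Prop :=
  ∀ f : ShiftQuotient E →ᵇ ℝ, (∀ᶠ q in 𝓝 (shiftClass (0 : C₀(ℤ, E))), f q = 0) →
    Tendsto (fun n => ∫ q, f q ∂(μ n)) atTop (𝓝 (∫ q, f q ∂ν))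

/-- The infargmax functional `inf {j : sup_{l ≤ j} |y_l| = sup_l |y_l|}`, with value `+∞` if
no such `j` exists and `-∞` if such `j` are not bounded below. -/
def infArgmax (y : ℤ → E) : EReal :=
  sInf ((fun j : ℤ => ((j : ℝ) : EReal)) '' {j : ℤ | (⨆ l ≤ j, ‖y l‖ₑ) = (⨆ l, ‖y l‖ₑ)})

/-- The class `𝒜`, relative to a measure `ν` on `ℓ₀`: bounded, shift-invariant (measurable)
functionals with support separated from zero which are Lipschitz for the uniform norm or
continuous at `ν`-almost every point. -/
structure ClassA (ν : Measure C₀(ℤ, E)) (H : C₀(ℤ, E) → ℝ) : Prop where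
  measurable : Measurable H
  bounded : ∃ C : ℝ, ∀ x, |H x| ≤ C
  shift_invariant : ∀ (k : ℤ) (x : C₀(ℤ, E)), H (shift k x) = H x
  support_separated : ∃ ε : ℝ, 0 < ε ∧ ∀ x : C₀(ℤ, E), ‖x‖ ≤ ε → H x = 0
  regular : (∃ K, LipschitzWith K H) ∨ ∀ᵐ x ∂ν, ContinuousAt H x

end Sequences

section TimeSeries

variable {E : Type*} [NormedAddCommGroup E] [NormedSpace ℝ E] [MeasurableSpace E]
  {Ω : Type*} [MeasurableSpace Ω]

/-- Strict stationarity of a two-sided time series. -/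
def IsStationary (P : Measure Ω) (X : ℤ → Ω → E) : Prop :=
  ∀ k : ℤ, IdentDistrib (fun ω (j : ℤ) => X (j + k) ω) (fun ω (j : ℤ) => X j ω) P P

/-- The rescaled finite-dimensional vector `c (X_i, …, X_j)`. -/
def scaledVector (X : ℤ → Ω → E) (i j : ℤ) (c : ℝ) (ω : Ω) : Finset.Icc i j → E :=
  fun l => c • X l ω

/-- A (stationary) time series is regularly varying with tail index `α > 0`: the tail of
`|X_0|` is regularly varying with index `-α` and, for all `i ≤ j`, the measures
`P(x⁻¹ (X_i, …, X_j) ∈ ·) / P(|X_0| > x)` converge vaguely away from zero, as `x → ∞`, to a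
measure which is finite on sets bounded away from zero. -/
structure IsRegularlyVarying (P : Measure Ω) (X : ℤ → Ω → E) (α : ℝ) : Prop where
  index_pos : 0 < α
  tail : ∀ t : ℝ, 0 < t → Tendsto
    (fun x : ℝ => P.real {ω | t * x < ‖X 0 ω‖} / P.real {ω | x < ‖X 0 ω‖})
    atTop (𝓝 (t ^ (-α)))
  fidi : ∀ i j : ℤ, i ≤ j → ∃ μ : Measure (Finset.Icc i j → E),
    (∀ ε : ℝ, 0 < ε → μ {v | ε ≤ ‖v‖} < ∞) ∧
    ∀ f : (Finset.Icc i j → E) →ᵇ ℝ, (∀ᶠ v in 𝓝 0, f v = 0) →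
      Tendsto (fun x : ℝ => (∫ ω, f (scaledVector X i j x⁻¹ ω) ∂P) / P.real {ω | x < ‖X 0 ω‖})
        atTop (𝓝 (∫ v, f v ∂μ))

/-- `Y` is the tail process of `X`: for all `i ≤ j`, the conditional law of
`x⁻¹ (X_i, …, X_j)` given `|X_0| > x` converges weakly to the law of `(Y_i, …, Y_j)`. -/
def IsTailProcess {Ω' : Type*} [MeasurableSpace Ω'] (P : Measure Ω) (X : ℤ → Ω → E)
    (P' : Measure Ω') (Y : ℤ → Ω' → E) : Prop :=
  ∀ i j : ℤ, i ≤ j → ∀ f : (Finset.Icc i j → E) →ᵇ ℝ,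
    Tendsto (fun x : ℝ => ∫ ω, f (scaledVector X i j x⁻¹ ω) ∂(P[|{ω | x < ‖X 0 ω‖}]))
      atTop (𝓝 (∫ ω, f (scaledVector Y i j 1 ω) ∂P'))

/-- The anticlustering condition: for all `x, y > 0`,
`lim_k limsup_n P(max_{k ≤ |j| ≤ r_n} |X_j| > u_n x ∣ |X_0| > u_n y) = 0`. -/
def Anticlustering (P : Measure Ω) (X : ℤ → Ω → E) (r : ℕ → ℕ) (u : ℕ → ℝ) : Prop :=
  ∀ x y : ℝ, 0 < x → 0 < y → Tendsto
    (fun k : ℕ => limsup (fun n : ℕ =>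
      P[|{ω | u n * y < ‖X 0 ω‖}]
        {ω | ∃ j : ℤ, (k : ℤ) ≤ |j| ∧ |j| ≤ (r n : ℤ) ∧ u n * x < ‖X j ω‖}) atTop)
    atTop (𝓝 0)

/-- The rescaled block `u⁻¹ (X_1, …, X_r)`, as an element of `ℓ₀`. -/
def block (X : ℤ → Ω → E) (r : ℕ) (u : ℝ) (ω : Ω) : C₀(ℤ, E) :=
  window 1 (r : ℤ) (fun j => u⁻¹ • X j ω)

/-- The measure `E[δ_{u⁻¹ X_{1,r}}] / (r P(|X_0| > u))` on `ℓ₀`. -/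
def blockMeasure (P : Measure Ω) (X : ℤ → Ω → E) (r : ℕ) (u : ℝ) : Measure C₀(ℤ, E) :=
  ((r : ℝ≥0∞) * P {ω | u < ‖X 0 ω‖})⁻¹ • P.map (block X r u)

/-- The spectral tail process `Θ_j = Y_j / |Y_0|`. -/
def spectral (Y : ℤ → Ω → E) (ω : Ω) : ℤ → E := fun j => ‖Y 0 ω‖⁻¹ • Y j ω

/-- The candidate extremal index `ϑ = P(infargmax of Y is 0)`. -/
def candidateExtremalIndex (P : Measure Ω) (Y : ℤ → Ω → E) : ℝ :=
  P.real {ω | infArgmax (fun j => Y j ω) = 0}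

/-- The measure `α r^{-α-1} dr` on `(0, ∞)`. -/
def radialMeasure (α : ℝ) : Measure ℝ :=
  (volume.restrict (Set.Ioi 0)).withDensity (fun r => ENNReal.ofReal (α * r ^ (-α - 1)))

/-- The cluster measure `∫_0^∞ E[δ_{rΘ} 1{infargmax of Θ is 0}] α r^{-α-1} dr` on `ℓ₀`. -/
def clusterMeasure (P : Measure Ω) (Y : ℤ → Ω → E) (α : ℝ) : Measure C₀(ℤ, E) :=
  ((radialMeasure α).prod (P.restrict {ω | infArgmax (spectral Y ω) = 0})).map
    (fun p => p.1 • toEllZero (spectral Y p.2))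

end TimeSeries

end

end ClusterRV

/-! Outside the unit ball `ν*` is the law of `Y` on the event that the first maximum of `Y` sits at
time 0 (`lintegral_clusterMeasure_of_support`); other radii follow because the radial measure is
homogeneous. The tool is the time change formula E[F(Y); |Y_j| > t] = t^(-α) E[F(t B^j Y); t|Y_{-j}|
> 1], B the backshift, which is what stationarity of `X` leaves in the limit
(`lintegral_timeChange`).

Let H ≥ 0 be Lipschitz, shift-invariant and zero on the unit ball. If H(X_{1,r}/u) ≠ 0, some |X_j|
exceeds u, so H can be shared out among the exceedances with continuous weights of sum 1
(`IsLipschitzTest.apply_window_eq_sum`). Stationarity moves the share of j to time 0. Hence E[H]/(r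
P(|X_0| > u)) is the average over j ≤ r of means, conditional on |X_0| > u, of functionals anchored
at 0 that see the times 1-j, ..., r-j. Anticlustering replaces this window by [-k, k], except for 2k
values of j near the ends (`IsLipschitzTest.abs_sub_integral_anchored_le`). Letting n → ∞ brings in
the tail process, and k → ∞ its whole path (`IsLipschitzTest.tendsto_integral_anchored`). Time
change with t = 1 then shows that anchoring by weights and anchoring at the first maximum give the
same mean (`lintegral_rampSum_anchor`).

Scaling reduces a support at distance ε to the unit ball, and positive and negative parts remove the
sign. For H continuous `ν*`-almost everywhere, Lipschitz minorants of H and of -H give the two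
bounds (`ClusterSetting.eventually_block_gt`). Part (a) is a pullback to `ℓ₀`; part (c) is the case
of the indicator of ‖x‖ > 1, as `ν*` does not charge the unit sphere. -/

namespace ClusterRV

/-! ### Sequences vanishing at infinity: norm, shifts, windows, first maximum. -/

section Sequences

variable {E : Type*} [NormedAddCommGroup E]

theorem norm_apply_le (x : C₀(ℤ, E)) (l : ℤ) : ‖x l‖ ≤ ‖x‖ := by
  rw [← ZeroAtInftyContinuousMap.norm_toBCF_eq_norm]
  exact x.toBCF.norm_coe_le_norm l

theorem norm_le_iff {x : C₀(ℤ, E)} {c : ℝ} (hc : 0 ≤ c) : ‖x‖ ≤ c ↔ ∀ l, ‖x l‖ ≤ c := by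
  rw [← ZeroAtInftyContinuousMap.norm_toBCF_eq_norm]
  exact BoundedContinuousFunction.norm_le hc

theorem lt_norm_iff {x : C₀(ℤ, E)} {c : ℝ} (hc : 0 ≤ c) : c < ‖x‖ ↔ ∃ l, c < ‖x l‖ := by
  simpa using (norm_le_iff (x := x) hc).not

theorem norm_sub_le_iff {x y : C₀(ℤ, E)} {c : ℝ} (hc : 0 ≤ c) :
    ‖x - y‖ ≤ c ↔ ∀ l, ‖x l - y l‖ ≤ c := by
  simpa using norm_le_iff (x := x - y) hc

theorem tendsto_cofinite (x : C₀(ℤ, E)) : Tendsto x cofinite (𝓝 0) := by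
  rw [← cocompact_eq_cofinite]
  exact x.zero_at_infty'

@[simp]
theorem ofTendsto_apply (y : ℤ → E) (h : Tendsto y cofinite (𝓝 0)) (l : ℤ) :
    ofTendsto y h l = y l := rfl

theorem window_apply (i j : ℤ) (y : ℤ → E) (l : ℤ) :
    window i j y l = if i ≤ l ∧ l ≤ j then y l else 0 := rfl

theorem toEllZero_of_tendsto {y : ℤ → E} (h : Tendsto y cofinite (𝓝 0)) :
    toEllZero y = ofTendsto y h := dif_pos h

theorem toEllZero_apply {y : ℤ → E} (h : Tendsto y cofinite (𝓝 0)) (l : ℤ) :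
    toEllZero y l = y l := by
  rw [toEllZero_of_tendsto h, ofTendsto_apply]

theorem norm_shift (k : ℤ) (x : C₀(ℤ, E)) : ‖shift k x‖ = ‖x‖ := by
  apply le_antisymm
  · exact (norm_le_iff (norm_nonneg _)).2 fun l => norm_apply_le x (l - k)
  · refine (norm_le_iff (norm_nonneg _)).2 fun l => ?_
    have := norm_apply_le (shift k x) (l + k)
    rwa [shift_apply, add_sub_cancel_right] at this

theorem shift_sub (k : ℤ) (x y : C₀(ℤ, E)) : shift k (x - y) = shift k x - shift k y := by
  ext l
  simp [shift_apply]

theorem shift_shift_neg (k : ℤ) (x : C₀(ℤ, E)) : shift k (shift (-k) x) = x := by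
  ext l
  simp [shift_apply]

theorem window_shift (i j k : ℤ) (y : ℤ → E) :
    window (i + k) (j + k) (fun l => y (l - k)) = shift k (window i j y) := by
  ext l
  rw [shift_apply, window_apply, window_apply]
  congr 1
  apply propext
  constructor <;> rintro ⟨h1, h2⟩ <;> constructor <;> linarith

theorem toEllZero_shift (k : ℤ) {y : ℤ → E} (h : Tendsto y cofinite (𝓝 0)) :
    toEllZero (fun l => y (l - k)) = shift k (toEllZero y) := by
  have h' : Tendsto (fun l => y (l - k)) cofinite (𝓝 0) :=
    h.comp (sub_left_injective (b := k)).tendsto_cofinite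
  ext l
  rw [shift_apply, toEllZero_apply h, toEllZero_apply h']

theorem continuous_window (i j : ℤ) : Continuous (window i j : (ℤ → E) → C₀(ℤ, E)) := by
  rw [continuous_iff_continuousAt]
  intro y
  rw [ContinuousAt, tendsto_iff_norm_sub_tendsto_zero]
  have hlim : Tendsto (fun z : ℤ → E => ∑ l ∈ Finset.Icc i j, ‖z l - y l‖) (𝓝 y) (𝓝 0) := by
    have : Continuous fun z : ℤ → E => ∑ l ∈ Finset.Icc i j, ‖z l - y l‖ := by fun_prop
    simpa using this.tendsto y
  refine squeeze_zero (fun _ => norm_nonneg _) (fun z => ?_) hlim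
  refine (norm_sub_le_iff (Finset.sum_nonneg fun _ _ => norm_nonneg _)).2 fun l => ?_
  rw [window_apply, window_apply]
  split_ifs with h
  · exact Finset.single_le_sum (f := fun l => ‖z l - y l‖) (fun _ _ => norm_nonneg _)
      (Finset.mem_Icc.2 h)
  · simpa using Finset.sum_nonneg fun _ _ => norm_nonneg _

theorem finite_not_norm_lt {y : ℤ → E} (h : Tendsto y cofinite (𝓝 0)) {c : ℝ} (hc : 0 < c) :
    {l : ℤ | ¬ ‖y l‖ < c}.Finite :=
  (tendsto_zero_iff_norm_tendsto_zero.1 h).eventually_lt_const hc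

/-- Uniform approximation of a sequence by continuous functions of finitely many coordinates;
measurability of `toEllZero` and the limit over growing windows both come from it. -/
theorem tendsto_window {y : ℤ → E} (h : Tendsto y cofinite (𝓝 0)) :
    Tendsto (fun k : ℕ => window (-(k : ℤ)) k y) atTop (𝓝 (toEllZero y)) := by
  rw [Metric.tendsto_atTop]
  intro ε hε
  have hfin : {l : ℤ | ¬ ‖y l‖ < ε / 2}.Finite :=
      finite_not_norm_lt h (half_pos hε)
  obtain ⟨N, hN⟩ : ∃ N : ℕ, ∀ l ∈ {l : ℤ | ¬ ‖y l‖ < ε / 2}, l.natAbs ≤ N := by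
    obtain ⟨N, hN⟩ := (hfin.image Int.natAbs).bddAbove
    exact ⟨N, fun l hl => hN ⟨l, hl, rfl⟩⟩
  refine ⟨N, fun n hn => ?_⟩
  rw [dist_eq_norm]
  refine lt_of_le_of_lt ?_ (half_lt_self hε)
  refine (norm_sub_le_iff (half_pos hε).le).2 fun l => ?_
  rw [window_apply, toEllZero_apply h]
  split_ifs with hl
  · simpa using (half_pos hε).le
  · rw [zero_sub, norm_neg]
    by_contra hcon
    have := hN l (fun h' => hcon h'.le)
    omega

theorem toEllZero_smul [NormedSpace ℝ E] (c : ℝ) (y : ℤ → E) :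
    toEllZero (c • y) = c • toEllZero y := by
  rcases eq_or_ne c 0 with rfl | hc
  -- The factor 0 is separate: it sends even a sequence outside `ℓ₀` into `ℓ₀`. Both sides are then
  -- 0.
  · rw [zero_smul, zero_smul, toEllZero_of_tendsto (by exact tendsto_const_nhds)]
    rfl
  · by_cases h : Tendsto y cofinite (𝓝 0)
    · have h' : Tendsto (c • y) cofinite (𝓝 0) := by
        have := h.const_smul c
        rwa [smul_zero] at this
      ext l
      rw [toEllZero_apply h', ZeroAtInftyContinuousMap.smul_apply, toEllZero_apply h]
      rfl
    · have h' : ¬ Tendsto (c • y) cofinite (𝓝 0) := by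
        intro h'
        apply h
        have := h'.const_smul c⁻¹
        simpa [smul_smul, inv_mul_cancel₀ hc] using this
      rw [toEllZero, toEllZero, dif_neg h, dif_neg h', smul_zero]

/-- The first maximum of the norms of the sequence is attained at `j`. -/
def IsFirstMax (y : ℤ → E) (j : ℤ) : Prop :=
  (∀ l, ‖y l‖ ≤ ‖y j‖) ∧ ∀ l < j, ‖y l‖ < ‖y j‖

theorem IsFirstMax.eq {y : ℤ → E} {i j : ℤ} (hi : IsFirstMax y i) (hj : IsFirstMax y j) :
    i = j := by
  rcases lt_trichotomy i j with h | h | h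
  · exact absurd (hj.2 i h) (not_lt.2 (hi.1 j))
  · exact h
  · exact absurd (hi.2 j h) (not_lt.2 (hj.1 i))

theorem isFirstMax_shift (k j : ℤ) (y : ℤ → E) :
    IsFirstMax (fun l => y (l - k)) j ↔ IsFirstMax y (j - k) := by
  constructor
  · rintro ⟨h1, h2⟩
    exact ⟨fun l => by simpa using h1 (l + k), fun l hl => by
      simpa using h2 (l + k) (by linarith)⟩
  · rintro ⟨h1, h2⟩
    exact ⟨fun l => h1 (l - k), fun l hl => h2 (l - k) (by linarith)⟩

theorem isFirstMax_smul [NormedSpace ℝ E] {c : ℝ} (hc : 0 < c) (y : ℤ → E) (j : ℤ) :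
    IsFirstMax (c • y) j ↔ IsFirstMax y j := by
  simp only [IsFirstMax, Pi.smul_apply, norm_smul, Real.norm_eq_abs, abs_of_pos hc]
  simp [mul_le_mul_iff_right₀ hc, mul_lt_mul_iff_right₀ hc]

/-- A nonzero sequence tending to zero attains its first maximum. -/
theorem exists_isFirstMax {y : ℤ → E} (h : Tendsto y cofinite (𝓝 0)) {i : ℤ} (hi : y i ≠ 0) :
    ∃ j, IsFirstMax y j := by
  have hfin : {l : ℤ | ¬ ‖y l‖ < ‖y i‖}.Finite :=
      finite_not_norm_lt h (norm_pos_iff.2 hi)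
  have hiF : i ∈ hfin.toFinset := by simp
  obtain ⟨m, hm, hmax⟩ := hfin.toFinset.exists_max_image (fun l => ‖y l‖) ⟨i, hiF⟩
  have hmax' : ∀ l, ‖y l‖ ≤ ‖y m‖ := by
    intro l
    by_cases hl : ‖y l‖ < ‖y i‖
    · exact hl.le.trans (hmax i hiF)
    · exact hmax l (by simpa using hl)
  have hfin' : {l : ℤ | ‖y l‖ = ‖y m‖}.Finite := by
    refine hfin.subset fun l hl => ?_
    have : ‖y l‖ = ‖y m‖ := hl
    simp only [Set.mem_ofPred_eq, not_lt, this]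
    exact hmax' i
  obtain ⟨j, hj, hmin⟩ := hfin'.toFinset.exists_min_image id ⟨m, by simp⟩
  have hj' : ‖y j‖ = ‖y m‖ := by simpa using hj
  refine ⟨j, fun l => hj' ▸ hmax' l, fun l hl => ?_⟩
  refine lt_of_le_of_ne (hj' ▸ hmax' l) fun hlj => ?_
  have := hmin l (by simp [hlj, hj'])
  exact absurd this (not_le.2 hl)

/-- The point is that no i < j qualifies: strict inequality at each l ≤ i must survive the supremum
over infinitely many l. It does since only finitely many norms reach half the maximum. -/
theorem infArgmax_eq_of_isFirstMax {y : ℤ → E} {j : ℤ} (h : Tendsto y cofinite (𝓝 0))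
    (hj : IsFirstMax y j) : infArgmax y = ((j : ℝ) : EReal) := by
  have hsup : (⨆ l, ‖y l‖ₑ) = ‖y j‖ₑ :=
    le_antisymm (iSup_le fun l => enorm_le_iff_norm_le.2 (hj.1 l)) (le_iSup (fun l => ‖y l‖ₑ) j)
  apply le_antisymm
  · apply sInf_le
    refine ⟨j, ?_, rfl⟩
    rw [Set.mem_ofPred_eq, hsup]
    exact le_antisymm (iSup₂_le fun l _ => enorm_le_iff_norm_le.2 (hj.1 l))
      (le_iSup₂ (f := fun l (_ : l ≤ j) => ‖y l‖ₑ) j le_rfl)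
  · apply le_sInf
    rintro _ ⟨i, hi, rfl⟩
    rw [EReal.coe_le_coe_iff, Int.cast_le]
    by_contra! hij
    rw [Set.mem_ofPred_eq, hsup] at hi
    have hpos : 0 < ‖y j‖ := (norm_nonneg _).trans_lt (hj.2 i hij)
    have hfin : {l : ℤ | ¬ ‖y l‖ < ‖y j‖ / 2}.Finite :=
      finite_not_norm_lt h (half_pos hpos)
    let S := (hfin.toFinset.filter (· ≤ i)).image fun l => ‖y l‖
    -- c is the maximum of ‖y j‖/2 and the finitely many larger norms at times up to i.
    obtain ⟨c, hc0, hcj, hc⟩ : ∃ c : ℝ, 0 ≤ c ∧ c < ‖y j‖ ∧ ∀ l ≤ i, ‖y l‖ ≤ c := by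
      have hne : (insert (‖y j‖ / 2) S).Nonempty := Finset.insert_nonempty _ _
      refine ⟨(insert (‖y j‖ / 2) S).max' hne, ?_, ?_, ?_⟩
      · exact (half_pos hpos).le.trans (Finset.le_max' _ _ (Finset.mem_insert_self _ _))
      · rw [Finset.max'_lt_iff]
        intro b hb
        rcases Finset.mem_insert.1 hb with rfl | hb
        · exact half_lt_self hpos
        · obtain ⟨l, hl, rfl⟩ := Finset.mem_image.1 hb
          exact hj.2 l ((Finset.mem_filter.1 hl).2.trans_lt hij)
      · intro l hl
        by_cases hlj : ‖y l‖ < ‖y j‖ / 2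
        · exact hlj.le.trans (Finset.le_max' _ _ (Finset.mem_insert_self _ _))
        · apply Finset.le_max'
          apply Finset.mem_insert_of_mem
          exact Finset.mem_image.2 ⟨l, Finset.mem_filter.2 ⟨by simpa using hlj, hl⟩, rfl⟩
    have hle : (⨆ l ≤ i, ‖y l‖ₑ) ≤ ENNReal.ofReal c := by
      refine iSup₂_le fun l hl => ?_
      rw [← ofReal_norm]
      exact ENNReal.ofReal_le_ofReal (hc l hl)
    rw [hi, ← ofReal_norm, ENNReal.ofReal_le_ofReal_iff hc0] at hle
    exact absurd hle (not_le.2 hcj)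

theorem infArgmax_eq_zero_iff {y : ℤ → E} (h : Tendsto y cofinite (𝓝 0)) {i : ℤ} (hi : y i ≠ 0) :
    infArgmax y = 0 ↔ IsFirstMax y 0 := by
  obtain ⟨j, hj⟩ := exists_isFirstMax h hi
  rw [infArgmax_eq_of_isFirstMax h hj]
  constructor
  · intro h0
    have : j = 0 := by exact_mod_cast h0
    exact this ▸ hj
  · intro h0
    simp [hj.eq h0]

theorem norm_toEllZero_of_isFirstMax {y : ℤ → E} {j : ℤ} (h : Tendsto y cofinite (𝓝 0))
    (hj : IsFirstMax y j) : ‖toEllZero y‖ = ‖y j‖ := by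
  apply le_antisymm
  · exact (norm_le_iff (norm_nonneg _)).2 fun l => by rw [toEllZero_apply h]; exact hj.1 l
  · simpa [toEllZero_apply h] using norm_apply_le (toEllZero y) j

/-! ### Measurability on sequence space. -/

section Measurability

variable [MeasurableSpace E] [BorelSpace E]

theorem measurable_window [SecondCountableTopology E] (i j : ℤ) :
    Measurable (window i j : (ℤ → E) → C₀(ℤ, E)) :=
  (continuous_window i j).measurable

theorem measurableSet_tendsto_cofinite :
    MeasurableSet {y : ℤ → E | Tendsto y cofinite (𝓝 0)} := by
  -- The union is over finite subsets of `ℤ`, a countable family.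
  have : {y : ℤ → E | Tendsto y cofinite (𝓝 0)} =
      ⋂ n : ℕ, ⋃ S : Finset ℤ, ⋂ l : ℤ, {y | l ∉ S → ‖y l‖ < 1 / ((n : ℝ) + 1)} := by
    ext y
    simp only [Set.mem_ofPred_eq, Set.mem_iInter, Set.mem_iUnion]
    rw [tendsto_zero_iff_norm_tendsto_zero]
    constructor
    · intro h n
      have := h.eventually_lt_const (u := 1 / ((n : ℝ) + 1)) (by positivity)
      rw [Filter.eventually_cofinite] at this
      exact ⟨this.toFinset, fun l hl => by simpa using hl⟩
    · intro h
      rw [Metric.tendsto_nhds]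
      intro ε hε
      obtain ⟨n, hn⟩ := exists_nat_one_div_lt hε
      obtain ⟨S, hS⟩ := h n
      rw [Filter.eventually_cofinite]
      refine S.finite_toSet.subset fun l hl => ?_
      by_contra hlS
      apply hl
      simpa using (hS l hlS).trans hn
  rw [this]
  refine MeasurableSet.iInter fun n => MeasurableSet.iUnion fun S => MeasurableSet.iInter fun l => ?_
  by_cases hl : l ∈ S
  · simp [hl]
  · simp only [hl, not_false_eq_true, forall_const]
    exact measurableSet_lt (measurable_pi_apply l).norm measurable_const

open Classical in
theorem measurable_toEllZero [SecondCountableTopology E] :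
    Measurable (toEllZero : (ℤ → E) → C₀(ℤ, E)) := by
  let S : Set (ℤ → E) := {y | Tendsto y cofinite (𝓝 0)}
  have hS : MeasurableSet S := measurableSet_tendsto_cofinite
  have hlim : Tendsto (fun (k : ℕ) (y : ℤ → E) => S.indicator (window (-(k : ℤ)) k) y) atTop
      (𝓝 toEllZero) := by
    rw [tendsto_pi_nhds]
    intro y
    by_cases hy : y ∈ S
    · simpa [Set.indicator_of_mem hy] using tendsto_window hy
    · have h0 : toEllZero y = 0 := dif_neg hy
      simp [Set.indicator_of_notMem hy, h0]
  exact measurable_of_tendsto_metrizable (fun k => (measurable_window _ _).indicator hS) hlim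

theorem measurableSet_isFirstMax (j : ℤ) : MeasurableSet {y : ℤ → E | IsFirstMax y j} := by
  have hm : ∀ l : ℤ, Measurable fun y : ℤ → E => ‖y l‖ := fun l => (measurable_pi_apply l).norm
  have : {y : ℤ → E | IsFirstMax y j} =
      (⋂ l : ℤ, {y | ‖y l‖ ≤ ‖y j‖}) ∩ ⋂ l : ℤ, ⋂ _ : l < j, {y | ‖y l‖ < ‖y j‖} := by
    ext y
    simp [IsFirstMax]
  rw [this]
  exact (MeasurableSet.iInter fun l => measurableSet_le (hm l) (hm j)).inter
    (MeasurableSet.iInter fun l => MeasurableSet.iInter fun _ => measurableSet_lt (hm l) (hm j))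

end Measurability

end Sequences

/-! ### The radial measure and its homogeneity. -/

section Radial

instance (α : ℝ) : SFinite (radialMeasure α) := by
  unfold radialMeasure
  infer_instance

theorem measurable_radialDensity (α : ℝ) :
    Measurable fun r : ℝ => ENNReal.ofReal (α * r ^ (-α - 1)) := by fun_prop

theorem lintegral_radialMeasure (α : ℝ) {g : ℝ → ℝ≥0∞} (hg : Measurable g) :
    ∫⁻ r, g r ∂(radialMeasure α) =
      ∫⁻ r in Set.Ioi 0, ENNReal.ofReal (α * r ^ (-α - 1)) * g r := by
  rw [radialMeasure, lintegral_withDensity_eq_lintegral_mul _ (measurable_radialDensity α) hg]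
  rfl

theorem radialMeasure_singleton (α r : ℝ) : radialMeasure α {r} = 0 :=
  (withDensity_absolutelyContinuous _ _).trans Measure.absolutelyContinuous_restrict
    (measure_singleton (μ := volume) r)

theorem ae_radialMeasure_pos (α : ℝ) : ∀ᵐ r ∂(radialMeasure α), 0 < r :=
  (withDensity_absolutelyContinuous _ _).ae_le
    (ae_restrict_mem (μ := volume) (measurableSet_Ioi (a := (0 : ℝ))))

theorem lintegral_radialMeasure_comp_mul (α : ℝ) {c : ℝ} (hc : 0 < c) {g : ℝ → ℝ≥0∞}
    (hg : Measurable g) :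
    ∫⁻ r, g (c * r) ∂(radialMeasure α) =
      ENNReal.ofReal (c ^ α) * ∫⁻ r, g r ∂(radialMeasure α) := by
  rw [lintegral_radialMeasure α (by fun_prop), lintegral_radialMeasure α hg,
    ← lintegral_indicator measurableSet_Ioi, ← lintegral_indicator measurableSet_Ioi]
  let h : ℝ → ℝ≥0∞ := (Set.Ioi (0 : ℝ)).indicator
    fun r => ENNReal.ofReal (α * r ^ (-α - 1)) * g r
  have hh : Measurable h :=
    ((measurable_radialDensity α).mul hg).indicator measurableSet_Ioi
  -- The density contributes c^(α+1); the Jacobian c⁻¹ below leaves c^α.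
  have hpt : ∀ r : ℝ, (Set.Ioi (0 : ℝ)).indicator
      (fun r => ENNReal.ofReal (α * r ^ (-α - 1)) * g (c * r)) r =
      ENNReal.ofReal (c ^ (α + 1)) * h (c * r) := by
    intro r
    by_cases hr : 0 < r
    · have hcr : 0 < c * r := mul_pos hc hr
      simp only [h]
      rw [Set.indicator_of_mem (Set.mem_Ioi.2 hr), Set.indicator_of_mem (Set.mem_Ioi.2 hcr),
        ← mul_assoc, ← ENNReal.ofReal_mul (by positivity)]
      congr 2
      rw [Real.mul_rpow hc.le hr.le, mul_left_comm, ← mul_assoc (c ^ (α + 1)),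
        ← Real.rpow_add hc]
      simp
    · have hcr : ¬ 0 < c * r := by
        rw [mul_pos_iff_of_pos_left hc]
        exact hr
      simp only [h]
      rw [Set.indicator_of_notMem (by simpa using hr), Set.indicator_of_notMem (by simpa using hcr),
        mul_zero]
  simp_rw [hpt]
  rw [lintegral_const_mul _ (by fun_prop)]
  have hmap : ∫⁻ r, h (c * r) = ENNReal.ofReal c⁻¹ * ∫⁻ r, h r := by
    rw [← lintegral_map hh (measurable_const_mul c), Real.map_volume_mul_left hc.ne',
      lintegral_smul_measure, abs_of_pos (inv_pos.2 hc), smul_eq_mul]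
  rw [hmap, ← mul_assoc, ← ENNReal.ofReal_mul (by positivity)]
  congr 2
  rw [Real.rpow_add hc, Real.rpow_one, mul_assoc, mul_inv_cancel₀ hc.ne', mul_one]

/-- The product t^(2α) · α t^(-α-1) is the derivative of t^α. In
`lintegral_clusterMeasure_of_support` the resulting power of ‖y 0‖ cancels the factor ‖y 0‖^(-α). -/
theorem lintegral_radialMeasure_pow {α : ℝ} (hα : 0 < α) {s : ℝ} (hs : 0 < s) :
    ∫⁻ t, ENNReal.ofReal (t ^ (2 * α)) * (Set.Iio s).indicator 1 t ∂(radialMeasure α) =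
      ENNReal.ofReal (s ^ α) := by
  have hm : Measurable ((Set.Iio s).indicator (1 : ℝ → ℝ≥0∞)) :=
    measurable_one.indicator measurableSet_Iio
  rw [lintegral_radialMeasure α
    (g := fun t => ENNReal.ofReal (t ^ (2 * α)) * (Set.Iio s).indicator 1 t)
    ((by fun_prop : Measurable fun t : ℝ => ENNReal.ofReal (t ^ (2 * α))).mul hm)]
  have h1 : ∫⁻ t in Set.Ioi (0 : ℝ), ENNReal.ofReal (α * t ^ (-α - 1)) *
      (ENNReal.ofReal (t ^ (2 * α)) * (Set.Iio s).indicator 1 t) =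
      ∫⁻ t in Set.Ioi (0 : ℝ), (Set.Iio s).indicator
        (fun t => ENNReal.ofReal (α * t ^ (α - 1))) t := by
    refine setLIntegral_congr_fun measurableSet_Ioi fun t ht => ?_
    have ht0 : 0 < t := ht
    by_cases hts : t < s
    · rw [Set.indicator_of_mem (Set.mem_Iio.2 hts), Set.indicator_of_mem (Set.mem_Iio.2 hts),
        Pi.one_apply, mul_one, ← ENNReal.ofReal_mul (by positivity), mul_assoc,
        ← Real.rpow_add ht0]
      congr 3
      ring
    · rw [Set.indicator_of_notMem (by simpa using hts), Set.indicator_of_notMem (by simpa using hts)]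
      simp
  rw [h1, setLIntegral_indicator measurableSet_Iio, Set.Iio_inter_Ioi,
    setLIntegral_congr Ioo_ae_eq_Ioc]
  have hint : IntervalIntegrable (fun t : ℝ => α * t ^ (α - 1)) volume 0 s :=
    (intervalIntegral.intervalIntegrable_rpow' (by linarith)).const_mul α
  rw [← ofReal_integral_eq_lintegral_ofReal
    ((intervalIntegrable_iff_integrableOn_Ioc_of_le hs.le).1 hint)]
  · rw [← intervalIntegral.integral_of_le hs.le, intervalIntegral.integral_const_mul,
      integral_rpow (Or.inl (by linarith)), sub_add_cancel, Real.zero_rpow hα.ne', sub_zero,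
      mul_div_cancel₀ _ hα.ne']
  · filter_upwards [ae_restrict_mem measurableSet_Ioc] with t ht
    have := ht.1
    positivity

end Radial

/-! ### Continuous cutoffs. -/

section Ramp

variable {E : Type*} [NormedAddCommGroup E]

/-- A continuous cutoff function, positive exactly where the norm exceeds `t`. -/
noncomputable def ramp (t : ℝ) (v : E) : ℝ := min 1 (max (‖v‖ - t) 0)

theorem continuous_ramp (t : ℝ) : Continuous (ramp t : E → ℝ) := by
  unfold ramp
  fun_prop

theorem ramp_nonneg (t : ℝ) (v : E) : 0 ≤ ramp t v := by simp [ramp]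

theorem ramp_le_one (t : ℝ) (v : E) : ramp t v ≤ 1 := by simp [ramp]

theorem ramp_pos_iff {t : ℝ} {v : E} : 0 < ramp t v ↔ t < ‖v‖ := by simp [ramp]

theorem ramp_eq_zero {t : ℝ} {v : E} (h : ‖v‖ ≤ t) : ramp t v = 0 :=
  le_antisymm (not_lt.1 (ramp_pos_iff.not.2 (not_lt.2 h))) (ramp_nonneg t v)

/-- The product of cutoffs at level `1` in the coordinate `0` and level `t` in the coordinate
`j`. -/
noncomputable def rampPair (t : ℝ) (j : ℤ) (y : ℤ → E) : ℝ := ramp 1 (y 0) * ramp t (y j)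

theorem continuous_rampPair (t : ℝ) (j : ℤ) : Continuous (rampPair t j : (ℤ → E) → ℝ) :=
  ((continuous_ramp 1).comp (continuous_apply 0)).mul ((continuous_ramp t).comp (continuous_apply j))

theorem rampPair_nonneg (t : ℝ) (j : ℤ) (y : ℤ → E) : 0 ≤ rampPair t j y :=
  mul_nonneg (ramp_nonneg _ _) (ramp_nonneg _ _)

theorem rampPair_le_one (t : ℝ) (j : ℤ) (y : ℤ → E) : rampPair t j y ≤ 1 :=
  mul_le_one₀ (ramp_le_one _ _) (ramp_nonneg _ _) (ramp_le_one _ _)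

theorem abs_rampPair_mul_le {t : ℝ} {j : ℤ} {y : ℤ → E} {a C : ℝ} (h : |a| ≤ C) :
    |rampPair t j y * a| ≤ C := by
  rw [abs_mul, abs_of_nonneg (rampPair_nonneg _ _ _)]
  exact (mul_le_of_le_one_left (abs_nonneg _) (rampPair_le_one _ _ _)).trans h

end Ramp

/-! ### Cylinder functionals and shifts. -/

section Cylinder

variable {E : Type*} [NormedAddCommGroup E] [MeasurableSpace E] [BorelSpace E]
  [SecondCountableTopology E]

/-- Finite measures on the space of sequences are determined by the integrals of bounded continuous
functions of finitely many coordinates. -/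
theorem ext_of_integral_cylinder {μ ν : Measure (ℤ → E)} [IsFiniteMeasure μ] [IsFiniteMeasure ν]
    (h : ∀ (f : (ℤ → E) → ℝ) (C : ℝ) (k : ℕ), Continuous f → (∀ y, |f y| ≤ C) →
      DependsOn f (Set.Icc (-(k : ℤ)) k) → ∫ y, f y ∂μ = ∫ y, f y ∂ν) : μ = ν := by
  apply ext_of_forall_integral_eq_of_IsFiniteMeasure
  intro f
  -- Setting the coordinates outside [-k, k] to 0 turns f into a cylinder functional, and dominated
  -- convergence recovers f.
  let T : ℕ → (ℤ → E) → (ℤ → E) := fun k => (Set.Icc (-(k : ℤ)) k).indicator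
  have hT : ∀ k, Continuous (T k) := by
    intro k
    refine continuous_pi fun l => ?_
    by_cases hl : l ∈ Set.Icc (-(k : ℤ)) k
    · simpa only [T, Set.indicator_of_mem hl] using continuous_apply l
    · simpa only [T, Set.indicator_of_notMem hl] using continuous_const
  have hTlim : ∀ y, Tendsto (fun k => T k y) atTop (𝓝 y) := by
    intro y
    rw [tendsto_pi_nhds]
    intro l
    refine tendsto_const_nhds.congr' ?_
    filter_upwards [eventually_ge_atTop l.natAbs] with k hk
    have : l ∈ Set.Icc (-(k : ℤ)) k := ⟨by omega, by omega⟩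
    simp only [T, Set.indicator_of_mem this]
  have hlim : ∀ (ρ : Measure (ℤ → E)) [IsFiniteMeasure ρ],
      Tendsto (fun k => ∫ y, f (T k y) ∂ρ) atTop (𝓝 (∫ y, f y ∂ρ)) := by
    intro ρ _
    refine tendsto_integral_of_dominated_convergence (fun _ => ‖f‖)
      (fun k => (f.continuous.comp (hT k)).aestronglyMeasurable) (integrable_const _)
      (fun k => .of_forall fun y => f.norm_coe_le_norm _)
      (.of_forall fun y => (f.continuous.tendsto y).comp (hTlim y))
  refine tendsto_nhds_unique (hlim μ) ?_
  have heq : ∀ k, ∫ y, f (T k y) ∂μ = ∫ y, f (T k y) ∂ν := by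
    intro k
    refine h _ ‖f‖ k (f.continuous.comp (hT k)) (fun y => f.norm_coe_le_norm _) ?_
    intro y z hyz
    refine congrArg f ?_
    ext l
    by_cases hl : l ∈ Set.Icc (-(k : ℤ)) k
    · exact (Set.indicator_of_mem hl y).trans
        ((hyz l hl).trans (Set.indicator_of_mem hl z).symm)
    · exact (Set.indicator_of_notMem hl y).trans (Set.indicator_of_notMem hl z).symm
  simp_rw [heq]
  exact hlim ν

end Cylinder

section Shift

variable {E : Type*} [NormedAddCommGroup E] [NormedSpace ℝ E]

/-- The sequence shifted by `j` and multiplied by `t`. -/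
def scaleShift (t : ℝ) (j : ℤ) (y : ℤ → E) : ℤ → E := fun l => t • y (l - j)

theorem continuous_scaleShift (t : ℝ) (j : ℤ) :
    Continuous (scaleShift t j : (ℤ → E) → (ℤ → E)) := by
  unfold scaleShift
  fun_prop

theorem dependsOn_scaleShift {f : (ℤ → E) → ℝ} {k : ℕ} (hd : DependsOn f (Set.Icc (-(k : ℤ)) k))
    (t : ℝ) (j : ℤ) : DependsOn (fun y => f (scaleShift t j y))
      (Set.Icc (-((k + j.natAbs : ℕ) : ℤ)) (k + j.natAbs : ℕ)) := by
  intro y z h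
  apply hd
  rintro l ⟨h1, h2⟩
  simp only [scaleShift]
  rw [h (l - j) ⟨by omega, by omega⟩]

end Shift

theorem IsStationary.integral_shift {E Ω : Type*} [MeasurableSpace E] [MeasurableSpace Ω]
    {P : Measure Ω} {X : ℤ → Ω → E}
    (hstat : IsStationary P X) {f : (ℤ → E) → ℝ} (hf : Measurable f)
    (j : ℤ) : ∫ ω, f (fun l => X (l + j) ω) ∂P = ∫ ω, f (fun l => X l ω) ∂P :=
  ((hstat j).comp hf).integral_eq

theorem measurable_path {E Ω : Type*} [MeasurableSpace E] [MeasurableSpace Ω] {Y : ℤ → Ω → E}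
    (hY : ∀ j, Measurable (Y j)) : Measurable fun ω j => Y j ω :=
  measurable_pi_lambda _ hY

/-! ### The tail process and the smoothed time change formula. -/

section TailProcess

variable {E : Type*} [NormedAddCommGroup E] [NormedSpace ℝ E] [MeasurableSpace E]
  {Ω : Type*} [MeasurableSpace Ω] {Ω' : Type*} [MeasurableSpace Ω']
  {P : Measure Ω} {X : ℤ → Ω → E} {P' : Measure Ω'} {Y : ℤ → Ω' → E} {α : ℝ}

/-- The law of a time series on the space of sequences. -/
noncomputable def pathLaw (P : Measure Ω) (X : ℤ → Ω → E) : Measure (ℤ → E) :=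
  P.map fun ω j => X j ω

/-- Regular variation at t = 1 says that a quotient of a number by itself tends to 1, while 0/0 = 0;
so the tail is nonzero at arbitrarily large levels, hence at every level. -/
theorem IsRegularlyVarying.tail_pos (hRV : IsRegularlyVarying P X α) [IsFiniteMeasure P] (x : ℝ) :
    0 < P.real {ω | x < ‖X 0 ω‖} := by
  have h := hRV.tail 1 one_pos
  simp only [one_mul, Real.one_rpow] at h
  obtain ⟨z, hz, hxz⟩ := ((h.eventually_ne one_ne_zero).and (eventually_ge_atTop x)).exists
  have hz' : P.real {ω | z < ‖X 0 ω‖} ≠ 0 := fun h0 => hz (by rw [h0, div_zero])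
  refine lt_of_lt_of_le (lt_of_le_of_ne measureReal_nonneg hz'.symm) (measureReal_mono ?_)
  exact fun ω (hω : z < _) => hxz.trans_lt hω

theorem isProbabilityMeasure_cond_tail (hRV : IsRegularlyVarying P X α) [IsFiniteMeasure P]
    (x : ℝ) : IsProbabilityMeasure (P[|{ω | x < ‖X 0 ω‖}]) := by
  apply cond_isProbabilityMeasure
  intro h0
  have := hRV.tail_pos x
  rw [measureReal_def, h0] at this
  simp at this

/-- Passes between conditional means and means under `P`, where stationarity is available. -/
theorem integral_cond_eq {s : Set Ω} (g : Ω → ℝ)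
    (hg : ∀ ω, ω ∉ s → g ω = 0) : ∫ ω, g ω ∂(P[|s]) = (∫ ω, g ω ∂P) / P.real s := by
  rw [ProbabilityTheory.cond, integral_smul_measure,
    setIntegral_eq_integral_of_forall_compl_eq_zero hg, ENNReal.toReal_inv, smul_eq_mul,
    inv_mul_eq_div, measureReal_def]

theorem IsTailProcess.tendsto_integral {E Ω Ω' : Type*} [NormedAddCommGroup E] [NormedSpace ℝ E]
    [MeasurableSpace Ω] [MeasurableSpace Ω'] {P : Measure Ω} {X : ℤ → Ω → E} {P' : Measure Ω'}
    {Y : ℤ → Ω' → E} (hXY : IsTailProcess P X P' Y) {f : (ℤ → E) → ℝ}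
    (hf : Continuous f) {C : ℝ} (hC : ∀ y, |f y| ≤ C) {k : ℕ}
    (hd : DependsOn f (Set.Icc (-(k : ℤ)) k)) :
    Tendsto (fun x : ℝ => ∫ ω, f (fun l => x⁻¹ • X l ω) ∂(P[|{ω | x < ‖X 0 ω‖}])) atTop
      (𝓝 (∫ ω, f (fun l => Y l ω) ∂P')) := by
  let e : (Finset.Icc (-(k : ℤ)) k → E) → (ℤ → E) := fun v l =>
    if h : l ∈ Finset.Icc (-(k : ℤ)) k then v ⟨l, h⟩ else 0
  have he : Continuous e := by
    refine continuous_pi fun l => ?_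
    by_cases hl : l ∈ Finset.Icc (-(k : ℤ)) k
    · simpa only [e, hl, dif_pos] using continuous_apply _
    · simpa only [e, hl, dif_neg, not_false_eq_true] using continuous_const
  have hres : ∀ y : ℤ → E, f (e fun l => y l) = f y := by
    intro y
    apply hd
    intro l hl
    have : l ∈ Finset.Icc (-(k : ℤ)) k := Finset.mem_Icc.2 hl
    exact dif_pos this
  have := hXY (-(k : ℤ)) k (by omega)
    (BoundedContinuousFunction.ofNormedAddCommGroup (f ∘ e) (hf.comp he) C fun v => hC _)
  have h1 : ∀ x : ℝ, ∀ ω, f (e (scaledVector X (-(k : ℤ)) k x⁻¹ ω)) = f fun l => x⁻¹ • X l ω :=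
    fun x ω => hres fun l => x⁻¹ • X l ω
  have h2 : ∀ ω, f (e (scaledVector Y (-(k : ℤ)) k 1 ω)) = f fun l => Y l ω := by
    intro ω
    have : scaledVector Y (-(k : ℤ)) k 1 ω =
        fun l : Finset.Icc (-(k : ℤ)) k => Y l ω := by
      ext l
      exact one_smul ℝ (Y l ω)
    rw [this]
    exact hres fun l => Y l ω
  simpa [h1, h2] using this

/-- The mean of F(X/x) under `P`, divided by P(|X_0| > x), is read in two ways. Since F vanishes
when ‖y 0‖ ≤ 1, it is a conditional mean given |X_0| > x. After a shift by j, it is P(|X_0| >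
tx)/P(|X_0| > x) times a conditional mean given |X_0| > tx, because the cutoff at level t in
coordinate j becomes a cutoff at level 1 in coordinate 0. The limits of the two readings are the two
sides. -/
theorem integral_rampPair_timeChange [BorelSpace E] [SecondCountableTopology E]
    [IsProbabilityMeasure P] (hstat : IsStationary P X) (hRV : IsRegularlyVarying P X α)
    (hXY : IsTailProcess P X P' Y) {f : (ℤ → E) → ℝ}
    (hf : Continuous f) {C : ℝ} (hC : ∀ y, |f y| ≤ C) {k : ℕ}
    (hd : DependsOn f (Set.Icc (-(k : ℤ)) k)) {t : ℝ} (ht : 0 < t) (j : ℤ) :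
    ∫ ω, rampPair t j (fun l => Y l ω) * f (fun l => Y l ω) ∂P' =
      t ^ (-α) * ∫ ω, rampPair t j (scaleShift t j fun l => Y l ω) *
        f (scaleShift t j fun l => Y l ω) ∂P' := by
  let F : (ℤ → E) → ℝ := fun y => rampPair t j y * f y
  have hF : Continuous F := (continuous_rampPair t j).mul hf
  have hFC : ∀ y, |F y| ≤ C := fun y => abs_rampPair_mul_le (hC y)
  have hFd : DependsOn F (Set.Icc (-((k + j.natAbs : ℕ) : ℤ)) (k + j.natAbs : ℕ)) := by
    intro y z h
    have h1 : f y = f z := hd fun l hl => h l ⟨by have := hl.1; omega,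
      by have := hl.2; omega⟩
    have h2 : rampPair t j y = rampPair t j z := by
      rw [rampPair, rampPair, h 0 ⟨by omega, by omega⟩, h j ⟨by omega, by omega⟩]
    simp only [F, h1, h2]
  have hF0 : ∀ y : ℤ → E, ‖y 0‖ ≤ 1 → F y = 0 := by
    intro y hy
    simp [F, rampPair, ramp_eq_zero hy]
  let F' : (ℤ → E) → ℝ := fun y => F (scaleShift t j y)
  have hF' : Continuous F' := hF.comp (continuous_scaleShift t j)
  have hF'0 : ∀ y : ℤ → E, ‖y 0‖ ≤ 1 → F' y = 0 := by
    intro y hy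
    have : ramp t (scaleShift t j y j) = 0 := by
      apply ramp_eq_zero
      simp only [scaleShift, sub_self, norm_smul, Real.norm_eq_abs, abs_of_pos ht]
      nlinarith
    simp [F', F, rampPair, this]
  have hlim1 := hXY.tendsto_integral hF hFC hFd
  have hlim2 := hXY.tendsto_integral hF' (fun y => hFC _) (dependsOn_scaleShift hFd t j)
  refine tendsto_nhds_unique hlim1 ?_
  -- The second reading is taken along the levels t * x, and the ratio of tails supplies t^(-α).
  have hlim3 := (hRV.tail t ht).mul (hlim2.comp (tendsto_id.const_mul_atTop ht))
  refine hlim3.congr' ?_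
  filter_upwards [eventually_gt_atTop 0] with x hx
  have htx : 0 < t * x := mul_pos ht hx
  have hsmall : ∀ {z : ℝ}, 0 < z → ∀ ω, ω ∉ {ω | z < ‖X 0 ω‖} → ‖z⁻¹ • X 0 ω‖ ≤ 1 := by
    intro z hz ω hω
    rw [norm_smul, norm_inv, Real.norm_eq_abs, abs_of_pos hz, inv_mul_le_iff₀ hz, mul_one]
    exact not_lt.1 hω
  simp only [Function.comp_apply, id]
  rw [integral_cond_eq _ fun ω hω => hF0 _ (hsmall hx ω hω),
    integral_cond_eq _ fun ω hω => hF'0 _ (hsmall htx ω hω), div_mul_div_comm,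
    mul_comm (P.real {ω | t * x < ‖X 0 ω‖}), mul_div_mul_right _ _ (hRV.tail_pos (t * x)).ne']
  congr 1
  have hm : Measurable fun y : ℤ → E => F fun l => x⁻¹ • y l := by
    have : Continuous fun y : ℤ → E => F fun l => x⁻¹ • y l := hF.comp (by fun_prop)
    exact this.measurable
  rw [← hstat.integral_shift hm (-j)]
  refine integral_congr_ae (.of_forall fun ω => ?_)
  simp only [F']
  congr 1
  ext l
  simp only [scaleShift, ← sub_eq_add_neg, smul_smul, mul_inv, mul_inv_cancel_left₀ ht.ne']

/-- The time change formula for the tail process, in smoothed form. -/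
theorem lintegral_rampPair_timeChange [BorelSpace E] [SecondCountableTopology E]
    [IsProbabilityMeasure P] [IsProbabilityMeasure P'] (hstat : IsStationary P X)
    (hRV : IsRegularlyVarying P X α) (hY : ∀ j, Measurable (Y j))
    (hXY : IsTailProcess P X P' Y) {F : (ℤ → E) → ℝ≥0∞} (hF : Measurable F)
    {t : ℝ} (ht : 0 < t) (j : ℤ) :
    ∫⁻ y, ENNReal.ofReal (rampPair t j y) * F y ∂(pathLaw P' Y) =
      ENNReal.ofReal (t ^ (-α)) * ∫⁻ y, ENNReal.ofReal (rampPair t j (scaleShift t j y)) *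
        F (scaleShift t j y) ∂(pathLaw P' Y) := by
  have : IsProbabilityMeasure (pathLaw P' Y) :=
    Measure.isProbabilityMeasure_map (measurable_path hY).aemeasurable
  let w : (ℤ → E) → ℝ := rampPair t j
  have hw : Continuous w := continuous_rampPair t j
  let T : (ℤ → E) → (ℤ → E) := scaleShift t j
  have hT : Continuous T := continuous_scaleShift t j
  have hwm : Measurable fun y => ENNReal.ofReal (w y) := hw.measurable.ennreal_ofReal
  have hwTm : Measurable fun y => ENNReal.ofReal (w (T y)) :=
    (hw.comp hT).measurable.ennreal_ofReal
  -- Both sides are integrals of F against finite measures; these agree on cylinder functionals by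
  -- `integral_rampPair_timeChange`, hence everywhere.
  let μ := (pathLaw P' Y).withDensity fun y => ENNReal.ofReal (w y)
  let ν := ENNReal.ofReal (t ^ (-α)) •
    ((pathLaw P' Y).withDensity fun y => ENNReal.ofReal (w (T y))).map T
  have hfin : ∀ g : (ℤ → E) → ℝ, (∀ y, g y ≤ 1) →
      IsFiniteMeasure ((pathLaw P' Y).withDensity fun y => ENNReal.ofReal (g y)) := by
    intro g hg
    apply isFiniteMeasure_withDensity
    refine ((lintegral_mono fun y => ENNReal.ofReal_le_ofReal (hg y)).trans_lt ?_).ne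
    simp
  have : IsFiniteMeasure μ := hfin _ fun y => rampPair_le_one _ _ _
  have := hfin (fun y => w (T y)) fun y => rampPair_le_one _ _ _
  have : IsFiniteMeasure ν := Measure.smul_finite _ ENNReal.ofReal_ne_top
  have hμν : μ = ν := by
    apply ext_of_integral_cylinder
    intro f C k hf hC hd
    have h1 := integral_rampPair_timeChange hstat hRV hXY hf hC hd ht j
    have hp : ∀ g : (ℤ → E) → ℝ, Continuous g →
        ∫ y, g y ∂(pathLaw P' Y) = ∫ ω, g (fun l => Y l ω) ∂P' := fun g hg =>
      integral_map (measurable_path hY).aemeasurable hg.aestronglyMeasurable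
    rw [← hp (fun y => w y * f y) (hw.mul hf),
      ← hp (fun y => w (T y) * f (T y)) ((hw.comp hT).mul (hf.comp hT))] at h1
    simp only [μ, ν]
    rw [integral_smul_measure, integral_map hT.measurable.aemeasurable hf.aestronglyMeasurable,
      integral_withDensity_eq_integral_toReal_smul hwm (.of_forall fun _ => ENNReal.ofReal_lt_top),
      integral_withDensity_eq_integral_toReal_smul hwTm (.of_forall fun _ => ENNReal.ofReal_lt_top),
      ENNReal.toReal_ofReal (by positivity)]
    simpa only [ENNReal.toReal_ofReal (rampPair_nonneg _ _ _), smul_eq_mul, w] using h1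
  have h2 : ∫⁻ y, F y ∂μ = ∫⁻ y, F y ∂ν := by rw [hμν]
  simp only [μ, ν] at h2
  rw [lintegral_smul_measure, lintegral_map hF hT.measurable,
    lintegral_withDensity_eq_lintegral_mul _ hwm hF,
    lintegral_withDensity_eq_lintegral_mul _ hwTm (g := fun y => F (T y)) (hF.comp hT.measurable)]
    at h2
  exact h2

/-- The first coordinate of the tail process exceeds one. -/
theorem ae_one_lt_norm [BorelSpace E]
    [IsProbabilityMeasure P] [IsProbabilityMeasure P'] (hX : Measurable (X 0))
    (hRV : IsRegularlyVarying P X α) (hY : ∀ j, Measurable (Y j)) (hXY : IsTailProcess P X P' Y) :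
    ∀ᵐ ω ∂P', 1 < ‖Y 0 ω‖ := by
  have hS : MeasurableSet {ω | 1 < ‖Y 0 ω‖} := measurableSet_lt measurable_const (hY 0).norm
  have hle : ∀ t : ℝ, 1 < t → t ^ (-α) ≤ P'.real {ω | 1 < ‖Y 0 ω‖} := by
    intro t ht
    -- g is continuous and lies between the indicators of ‖y 0‖ ≥ t and ‖y 0‖ > 1. The first gives
    -- the lower bound t^(-α) in the limit, the second the upper bound; then t decreases to 1.
    let g : (ℤ → E) → ℝ := fun y => min 1 (max ((‖y 0‖ - 1) / (t - 1)) 0)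
    have hg : Continuous g := by
      have : t - 1 ≠ 0 := by linarith
      fun_prop
    have hg0 : ∀ y, 0 ≤ g y := fun y => by simp [g]
    have hg1 : ∀ y, g y ≤ 1 := fun y => by simp [g]
    have hlim := hXY.tendsto_integral hg (C := 1)
      (fun y => by rw [abs_of_nonneg (hg0 y)]; exact hg1 y) (k := 0) (fun y z h => by
        simp only [g]; rw [h 0 ⟨by simp, by simp⟩])
    have hupper : ∫ ω, g (fun l => Y l ω) ∂P' ≤ P'.real {ω | 1 < ‖Y 0 ω‖} := by
      rw [← integral_indicator_one hS]
      refine integral_mono_of_nonneg (.of_forall fun ω => hg0 fun l => Y l ω)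
        ((integrable_const 1).indicator hS) (.of_forall fun ω => ?_)
      by_cases hω : 1 < ‖Y 0 ω‖
      · simpa [Set.indicator_of_mem (s := {ω | 1 < ‖Y 0 ω‖}) hω] using hg1 fun l => Y l ω
      · rw [Set.indicator_of_notMem (s := {ω | 1 < ‖Y 0 ω‖}) hω]
        have : (‖Y 0 ω‖ - 1) / (t - 1) ≤ 0 :=
          div_nonpos_of_nonpos_of_nonneg (by linarith) (by linarith)
        simp [g, max_eq_right this]
    refine le_trans (le_of_tendsto_of_tendsto (hRV.tail t (by linarith)) hlim ?_) hupper
    filter_upwards [eventually_gt_atTop 0] with x hx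
    have hprob := isProbabilityMeasure_cond_tail hRV x
    have hA : MeasurableSet {ω | x < ‖X 0 ω‖} := measurableSet_lt measurable_const hX.norm
    have hB : MeasurableSet {ω | t * x < ‖X 0 ω‖} := measurableSet_lt measurable_const hX.norm
    have h1 : P.real {ω | t * x < ‖X 0 ω‖} / P.real {ω | x < ‖X 0 ω‖} =
        ∫ ω, ({ω | t * x < ‖X 0 ω‖}).indicator 1 ω ∂(P[|{ω | x < ‖X 0 ω‖}]) := by
      rw [integral_cond_eq, integral_indicator_one hB]
      intro ω hω
      apply Set.indicator_of_notMem
      intro hω'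
      apply hω
      have : t * x < ‖X 0 ω‖ := hω'
      change x < ‖X 0 ω‖
      nlinarith
    rw [h1]
    refine integral_mono_of_nonneg (.of_forall fun ω => Set.indicator_nonneg (by simp) _) ?_
      (.of_forall fun ω => ?_)
    · refine Integrable.of_bound (C := 1) ?_ (.of_forall fun ω => ?_)
      · have : Measurable fun ω => min 1 (max ((‖x⁻¹ • X 0 ω‖ - 1) / (t - 1)) 0) := by fun_prop
        exact this.aestronglyMeasurable
      · rw [Real.norm_eq_abs, abs_of_nonneg (hg0 fun l => x⁻¹ • X l ω)]
        exact hg1 fun l => x⁻¹ • X l ω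
    · beta_reduce
      by_cases hω : t * x < ‖X 0 ω‖
      · rw [Set.indicator_of_mem (s := {ω | t * x < ‖X 0 ω‖}) hω]
        have h3 : t ≤ ‖x⁻¹ • X 0 ω‖ := by
          rw [norm_smul, norm_inv, Real.norm_eq_abs, abs_of_pos hx, inv_mul_eq_div, le_div_iff₀ hx]
          exact hω.le
        have : 1 ≤ (‖x⁻¹ • X 0 ω‖ - 1) / (t - 1) := by
          rw [le_div_iff₀ (by linarith)]
          linarith
        simp [g, this]
      · rw [Set.indicator_of_notMem (s := {ω | t * x < ‖X 0 ω‖}) hω]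
        exact hg0 fun l => x⁻¹ • X l ω
  have hlim : Tendsto (fun t : ℝ => t ^ (-α)) (𝓝[>] 1) (𝓝 1) := by
    have : ContinuousAt (fun t : ℝ => t ^ (-α)) 1 :=
      Real.continuousAt_rpow_const _ _ (Or.inl one_ne_zero)
    simpa using this.tendsto.mono_left nhdsWithin_le_nhds
  have hge : 1 ≤ P'.real {ω | 1 < ‖Y 0 ω‖} :=
    le_of_tendsto hlim (eventually_nhdsWithin_of_forall fun t ht => hle t ht)
  have : P' {ω | 1 < ‖Y 0 ω‖} = 1 := by
    apply le_antisymm prob_le_one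
    simpa [measureReal_def] using ENNReal.ofReal_le_ofReal hge
  rw [← mem_ae_iff_prob_eq_one hS] at this
  exact this

end TailProcess

/-! ### Decay of the tail process, time change, and anchoring. -/

section ClusterMeasure

variable {E : Type*} [NormedAddCommGroup E] [NormedSpace ℝ E] [MeasurableSpace E]
  [BorelSpace E] [SecondCountableTopology E] {Ω : Type*} [MeasurableSpace Ω] {Ω' : Type*}
  [MeasurableSpace Ω'] {P : Measure Ω} {X : ℤ → Ω → E} {P' : Measure Ω'} {Y : ℤ → Ω' → E} {α : ℝ}

/-- Under anticlustering the tail process tends to zero almost surely. -/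
theorem ae_tendsto_zero [IsProbabilityMeasure P] [IsProbabilityMeasure P']
    (hX : ∀ j, Measurable (X j)) (hRV : IsRegularlyVarying P X α)
    (hY : ∀ j, Measurable (Y j)) (hXY : IsTailProcess P X P' Y) {r : ℕ → ℕ} {u : ℕ → ℝ}
    (hr : Tendsto r atTop atTop) (hu : Tendsto u atTop atTop) (hAC : Anticlustering P X r u) :
    ∀ᵐ ω ∂P', Tendsto (fun j => Y j ω) cofinite (𝓝 0) := by
  let L : ℝ → ℕ → ℝ≥0∞ := fun η k => limsup (fun n : ℕ => P[|{ω | u n * 1 < ‖X 0 ω‖}]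
        {ω | ∃ j : ℤ, (k : ℤ) ≤ |j| ∧ |j| ≤ (r n : ℤ) ∧ u n * η < ‖X j ω‖}) atTop
  -- The bound does not depend on m, since r n ≥ m for large n; so m → ∞ is allowed before k → ∞.
  have hB : ∀ (η : ℝ), 0 < η → ∀ k m : ℕ,
      P' {ω | ∃ j : ℤ, (k : ℤ) ≤ |j| ∧ |j| ≤ (m : ℤ) ∧ 2 * η < ‖Y j ω‖} ≤ L η k := by
    intro η hη k m
    let S : Finset ℤ := (Finset.Icc (-(m : ℤ)) m).filter fun l => (k : ℤ) ≤ |l|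
    have hS : ∀ j : ℤ, j ∈ S ↔ (k : ℤ) ≤ |j| ∧ |j| ≤ (m : ℤ) := by
      intro j
      simp only [S, Finset.mem_filter, Finset.mem_Icc, abs_le]
      tauto
    -- On the coordinates in S, g equals 1 as soon as one norm is at least 2η, and 0 if none exceeds
    -- η. The factor 2 pays for continuity.
    let g : (ℤ → E) → ℝ := fun y => min 1 (∑ l ∈ S, max (‖y l‖ - η) 0 / η)
    have hg : Continuous g := by fun_prop
    have hsum0 : ∀ y : ℤ → E, 0 ≤ ∑ l ∈ S, max (‖y l‖ - η) 0 / η := fun y =>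
      Finset.sum_nonneg fun l _ => by positivity
    have hg0 : ∀ y : ℤ → E, 0 ≤ g y := fun y => le_min zero_le_one (hsum0 y)
    have hg1 : ∀ y : ℤ → E, g y ≤ 1 := fun y => min_le_left _ _
    have hlim := (hXY.tendsto_integral hg (C := 1)
      (fun y => by rw [abs_of_nonneg (hg0 y)]; exact hg1 y) (k := m) (fun y z h => by
        simp only [g]
        congr 1
        refine Finset.sum_congr rfl fun l hl => ?_
        rw [h l (Finset.mem_Icc.1 (Finset.mem_filter.1 hl).1)])).comp hu
    have hlim' := (ENNReal.continuous_ofReal.tendsto _).comp hlim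
    have hlow : P' {ω | ∃ j : ℤ, (k : ℤ) ≤ |j| ∧ |j| ≤ (m : ℤ) ∧ 2 * η < ‖Y j ω‖} ≤
        ENNReal.ofReal (∫ ω, g (fun l => Y l ω) ∂P') := by
      have hgm : Measurable fun ω => g fun l => Y l ω := hg.measurable.comp (measurable_path hY)
      rw [ofReal_integral_eq_lintegral_ofReal
        (Integrable.of_bound hgm.aestronglyMeasurable 1 (.of_forall fun ω => by
          rw [Real.norm_eq_abs, abs_of_nonneg (hg0 fun l => Y l ω)]
          exact hg1 fun l => Y l ω)) (.of_forall fun ω => hg0 fun l => Y l ω)]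
      refine (measure_mono fun ω hω => ?_).trans
        (mul_meas_ge_le_lintegral (hgm.ennreal_ofReal) 1 |> fun h => by simpa using h)
      obtain ⟨j, hj1, hj2, hj3⟩ := hω
      have h1 : 1 ≤ ∑ l ∈ S, max (‖Y l ω‖ - η) 0 / η := by
        refine le_trans ?_ (Finset.single_le_sum (f := fun l => max (‖Y l ω‖ - η) 0 / η)
          (fun l _ => by positivity) ((hS j).2 ⟨hj1, hj2⟩))
        rw [le_div_iff₀ hη, one_mul]
        exact le_max_of_le_left (by linarith)
      have h2 : g (fun l => Y l ω) = 1 := min_eq_left h1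
      simp [h2]
    refine hlow.trans ?_
    rw [← hlim'.limsup_eq]
    apply limsup_le_limsup ?_
    filter_upwards [hr.eventually_ge_atTop m, hu.eventually_gt_atTop 0] with n hn hun
    have hprob := isProbabilityMeasure_cond_tail hRV (u n)
    simp only [Function.comp_apply, mul_one]
    set A := {ω | ∃ j : ℤ, (k : ℤ) ≤ |j| ∧ |j| ≤ (r n : ℤ) ∧ u n * η < ‖X j ω‖} with hA
    have hAm : MeasurableSet A := by
      have : A = ⋃ j : ℤ, {ω | (k : ℤ) ≤ |j| ∧ |j| ≤ (r n : ℤ) ∧ u n * η < ‖X j ω‖} := by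
        ext ω
        simp [hA]
      rw [this]
      exact MeasurableSet.iUnion fun j => (MeasurableSet.const _).inter
        ((MeasurableSet.const _).inter (measurableSet_lt measurable_const (hX j).norm))
    rw [← ofReal_measureReal, ← integral_indicator_one hAm]
    apply ENNReal.ofReal_le_ofReal
    refine integral_mono_of_nonneg (.of_forall fun ω => hg0 fun l => (u n)⁻¹ • X l ω)
      ((integrable_const 1).indicator hAm) (.of_forall fun ω => ?_)
    by_cases hω : ω ∈ A
    · simpa [Set.indicator_of_mem hω] using hg1 fun l => (u n)⁻¹ • X l ω
    · rw [Set.indicator_of_notMem hω]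
      refine (min_le_right _ _).trans (Finset.sum_nonpos fun l hl => ?_)
      obtain ⟨h1, h2⟩ := (hS l).1 hl
      have h3 : ‖X l ω‖ ≤ u n * η := by
        by_contra! h
        exact hω ⟨l, h1, h2.trans (by exact_mod_cast hn), h⟩
      have h4 : ‖(u n)⁻¹ • X l ω‖ ≤ η := by
        rw [norm_smul, norm_inv, Real.norm_eq_abs, abs_of_pos hun, inv_mul_le_iff₀ hun]
        exact h3
      rw [max_eq_right (by linarith), zero_div]
  have hC : ∀ (η : ℝ), 0 < η →
      P' (⋂ k : ℕ, {ω | ∃ j : ℤ, (k : ℤ) ≤ |j| ∧ 2 * η < ‖Y j ω‖}) = 0 := by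
    intro η hη
    rw [← nonpos_iff_eq_zero]
    refine ge_of_tendsto' (hAC η 1 hη one_pos) fun k => (measure_mono (Set.iInter_subset _ k)).trans ?_
    have hU : {ω | ∃ j : ℤ, (k : ℤ) ≤ |j| ∧ 2 * η < ‖Y j ω‖} =
        ⋃ m : ℕ, {ω | ∃ j : ℤ, (k : ℤ) ≤ |j| ∧ |j| ≤ (m : ℤ) ∧ 2 * η < ‖Y j ω‖} := by
      ext ω
      simp only [Set.mem_iUnion]
      constructor
      · rintro ⟨j, h1, h2⟩
        exact ⟨j.natAbs, j, h1, (Int.natCast_natAbs j).ge, h2⟩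
      · rintro ⟨m, j, h1, -, h2⟩
        exact ⟨j, h1, h2⟩
    have hmono : Monotone fun m : ℕ =>
        {ω | ∃ j : ℤ, (k : ℤ) ≤ |j| ∧ |j| ≤ (m : ℤ) ∧ 2 * η < ‖Y j ω‖} := by
      rintro m m' hmm ω ⟨j, h1, h2, h3⟩
      exact ⟨j, h1, h2.trans (by exact_mod_cast hmm), h3⟩
    rw [hU, hmono.measure_iUnion]
    exact iSup_le fun m => hB η hη k m
  have hall : ∀ᵐ ω ∂P', ∀ n : ℕ, ω ∉ ⋂ k : ℕ,
      {ω | ∃ j : ℤ, (k : ℤ) ≤ |j| ∧ 2 * (1 / ((n : ℝ) + 1)) < ‖Y j ω‖} :=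
    ae_all_iff.2 fun n => measure_eq_zero_iff_ae_notMem.1 (hC _ (by positivity))
  filter_upwards [hall] with ω hω
  rw [Metric.tendsto_nhds]
  intro ε hε
  obtain ⟨n, hn⟩ := exists_nat_one_div_lt (half_pos hε)
  have h1 := hω n
  simp only [Set.mem_iInter, not_forall] at h1
  obtain ⟨k, hk⟩ := h1
  rw [Filter.eventually_cofinite]
  refine (Set.finite_Icc (-(k : ℤ)) k).subset fun j hj => ?_
  by_contra hjk
  refine hk ⟨j, ?_, ?_⟩
  · rw [Set.mem_Icc, ← abs_le, not_le] at hjk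
    exact hjk.le
  · have : ε ≤ ‖Y j ω‖ := by simpa using hj
    linarith

/-- The time change formula for the tail process. -/
theorem lintegral_timeChange
    [IsProbabilityMeasure P] [IsProbabilityMeasure P'] (hstat : IsStationary P X)
    (hRV : IsRegularlyVarying P X α) (hY : ∀ j, Measurable (Y j))
    (hXY : IsTailProcess P X P' Y) (h1 : ∀ᵐ y ∂(pathLaw P' Y), 1 < ‖y 0‖)
    {F : (ℤ → E) → ℝ≥0∞} (hF : Measurable F) {t : ℝ} (ht : 0 < t) (j : ℤ) :
    ∫⁻ y, {y : ℤ → E | t < ‖y j‖}.indicator F y ∂(pathLaw P' Y) =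
      ENNReal.ofReal (t ^ (-α)) *
        ∫⁻ y, {y : ℤ → E | 1 < ‖y 0‖}.indicator F (scaleShift t j y) ∂(pathLaw P' Y) := by
  have hw : Measurable fun y : ℤ → E => ENNReal.ofReal (rampPair t j y) :=
    (continuous_rampPair t j).measurable.ennreal_ofReal
  -- Dividing F by the cutoff weight removes the smoothing. As |Y_0| > 1 almost surely, the weight
  -- is positive where the indicator is 1: on the left this needs ‖y j‖ > t, on the right only that
  -- coordinate 0 of the shifted sequence exceeds 1.
  have key := lintegral_rampPair_timeChange hstat hRV hY hXY
    (F := fun y => F y / ENNReal.ofReal (rampPair t j y)) (hF.div hw) ht j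
  have hcancel : ∀ y : ℤ → E, 1 < ‖y 0‖ → t < ‖y j‖ → ENNReal.ofReal (rampPair t j y) *
      (F y / ENNReal.ofReal (rampPair t j y)) = F y := by
    intro y hy0 hyj
    have : 0 < rampPair t j y := mul_pos (ramp_pos_iff.2 hy0) (ramp_pos_iff.2 hyj)
    exact ENNReal.mul_div_cancel (ENNReal.ofReal_pos.2 this).ne' ENNReal.ofReal_ne_top
  have hzero : ∀ y : ℤ → E, (‖y 0‖ ≤ 1 ∨ ‖y j‖ ≤ t) → ENNReal.ofReal (rampPair t j y) *
      (F y / ENNReal.ofReal (rampPair t j y)) = 0 := by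
    intro y hy
    have : rampPair t j y = 0 := by
      rcases hy with hy | hy <;> simp [rampPair, ramp_eq_zero hy]
    simp [this]
  refine Eq.trans (lintegral_congr_ae ?_) (key.trans (congrArg _ (lintegral_congr_ae ?_)))
  · filter_upwards [h1] with y hy
    by_cases hyj : t < ‖y j‖
    · rw [Set.indicator_of_mem (s := {y : ℤ → E | t < ‖y j‖}) hyj, hcancel y hy hyj]
    · rw [Set.indicator_of_notMem (s := {y : ℤ → E | t < ‖y j‖}) hyj,
        hzero y (Or.inr (not_lt.1 hyj))]
  · filter_upwards [h1] with y hy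
    have hj : t < ‖scaleShift t j y j‖ := by
      simp only [scaleShift, sub_self, norm_smul, Real.norm_eq_abs, abs_of_pos ht]
      nlinarith
    by_cases hy0 : 1 < ‖scaleShift t j y 0‖
    · rw [Set.indicator_of_mem (s := {y : ℤ → E | 1 < ‖y 0‖}) hy0, hcancel _ hy0 hj]
    · rw [Set.indicator_of_notMem (s := {y : ℤ → E | 1 < ‖y 0‖}) hy0,
        hzero _ (Or.inl (not_lt.1 hy0))]

/-- The total weight of the exceedances of level one. -/
noncomputable def rampSum (y : ℤ → E) : ℝ≥0∞ := ∑' l, ENNReal.ofReal (ramp 1 (y l))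

/-- The tail process anchored at its first maximum or weighted by its exceedances. -/
theorem lintegral_rampSum_anchor
    [IsProbabilityMeasure P] [IsProbabilityMeasure P'] (hstat : IsStationary P X)
    (hRV : IsRegularlyVarying P X α) (hY : ∀ j, Measurable (Y j))
    (hXY : IsTailProcess P X P' Y) (h1 : ∀ᵐ y ∂(pathLaw P' Y), 1 < ‖y 0‖)
    (h0 : ∀ᵐ y ∂(pathLaw P' Y), Tendsto y cofinite (𝓝 0))
    {h : C₀(ℤ, E) → ℝ≥0∞} (hh : Measurable h) (hinv : ∀ k x, h (shift k x) = h x) :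
    ∫⁻ y, h (toEllZero y) * (ENNReal.ofReal (ramp 1 (y 0)) / rampSum y) ∂(pathLaw P' Y) =
      ∫⁻ y in {y | IsFirstMax y 0}, h (toEllZero y) ∂(pathLaw P' Y) := by
  have hm : ∀ l : ℤ, Measurable fun y : ℤ → E => ENNReal.ofReal (ramp 1 (y l)) := fun l =>
    ((continuous_ramp 1).comp (continuous_apply l)).measurable.ennreal_ofReal
  have hW : Measurable (rampSum : (ℤ → E) → ℝ≥0∞) := Measurable.tsum hm
  have hhm : Measurable fun y : ℤ → E => h (toEllZero y) := hh.comp measurable_toEllZero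
  let A : (ℤ → E) → ℝ≥0∞ := fun y => h (toEllZero y) * (ENNReal.ofReal (ramp 1 (y 0)) / rampSum y)
  have hA : Measurable A := hhm.mul ((hm 0).div hW)
  -- The mean is split by the location j of the first maximum. Time change carries j to 0 and turns
  -- the weight of coordinate 0 into that of -j; these weights sum to 1.
  let B : ℤ → (ℤ → E) → ℝ≥0∞ := fun j => {y | IsFirstMax y j}.indicator A
  have hB : ∀ j, Measurable (B j) := fun j => hA.indicator (measurableSet_isFirstMax j)
  have hsplit : ∫⁻ y, A y ∂(pathLaw P' Y) = ∑' j, ∫⁻ y, B j y ∂(pathLaw P' Y) := by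
    rw [← lintegral_tsum fun j => (hB j).aemeasurable]
    apply lintegral_congr_ae
    filter_upwards [h1, h0] with y hy1 hy0
    obtain ⟨j, hj⟩ := exists_isFirstMax hy0 (norm_pos_iff.1 (one_pos.trans hy1))
    rw [tsum_eq_single j]
    · exact (Set.indicator_of_mem (s := {y | IsFirstMax y j}) hj A).symm
    · intro i hi
      exact Set.indicator_of_notMem (s := {y | IsFirstMax y i}) (fun h => hi (h.eq hj)) A
  have hshift : ∀ j, ∫⁻ y, B j y ∂(pathLaw P' Y) = ∫⁻ y, {y | IsFirstMax y 0}.indicator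
      (fun y => h (toEllZero y) * (ENNReal.ofReal (ramp 1 (y (-j))) / rampSum y)) y
        ∂(pathLaw P' Y) := by
    intro j
    -- The indicator needed for time change is free: a maximum at j dominates |y_0| > 1.
    have e1 : ∫⁻ y, B j y ∂(pathLaw P' Y) =
        ∫⁻ y, {y : ℤ → E | 1 < ‖y j‖}.indicator (B j) y ∂(pathLaw P' Y) := by
      apply lintegral_congr_ae
      filter_upwards [h1] with y hy
      by_cases hj : 1 < ‖y j‖
      · rw [Set.indicator_of_mem (s := {y : ℤ → E | 1 < ‖y j‖}) hj]
      · rw [Set.indicator_of_notMem (s := {y : ℤ → E | 1 < ‖y j‖}) hj]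
        exact Set.indicator_of_notMem (s := {y | IsFirstMax y j})
          (fun h => hj (hy.trans_le (h.1 0))) A
    rw [e1, lintegral_timeChange hstat hRV hY hXY h1 (hB j) one_pos j, Real.one_rpow,
      ENNReal.ofReal_one, one_mul]
    apply lintegral_congr_ae
    filter_upwards [h0] with y hy0
    have hs : scaleShift 1 j y = fun l => y (l - j) := by
      ext l
      simp [scaleShift]
    have hWs : rampSum (fun l => y (l - j)) = rampSum y :=
      (Equiv.subRight j).tsum_eq fun l => ENNReal.ofReal (ramp 1 (y l))
    have hAs : A (fun l => y (l - j)) =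
        h (toEllZero y) * (ENNReal.ofReal (ramp 1 (y (-j))) / rampSum y) := by
      simp only [A]
      rw [hWs, toEllZero_shift j hy0, hinv, zero_sub]
    rw [hs]
    have hiff : IsFirstMax (fun l => y (l - j)) j ↔ IsFirstMax y 0 := by
      rw [isFirstMax_shift, sub_self]
    by_cases hF : IsFirstMax y 0
    · rw [Set.indicator_of_mem (s := {y | IsFirstMax y 0}) hF]
      have hBs : B j (fun l => y (l - j)) =
          h (toEllZero y) * (ENNReal.ofReal (ramp 1 (y (-j))) / rampSum y) :=
        (Set.indicator_of_mem (s := {y | IsFirstMax y j}) (hiff.2 hF) A).trans hAs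
      -- The indicator left over by time change is also free, the weight of -j being 0 where it
      -- vanishes.
      by_cases hj : 1 < ‖y (0 - j)‖
      · exact (Set.indicator_of_mem (s := {y : ℤ → E | 1 < ‖y 0‖})
          (a := fun l => y (l - j)) hj (B j)).trans hBs
      · rw [Set.indicator_of_notMem (s := {y : ℤ → E | 1 < ‖y 0‖})
          (a := fun l => y (l - j)) hj (B j)]
        rw [zero_sub, not_lt] at hj
        simp [ramp_eq_zero hj]
    · rw [Set.indicator_of_notMem (s := {y | IsFirstMax y 0}) hF]
      have hBs : B j (fun l => y (l - j)) = 0 :=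
        Set.indicator_of_notMem (s := {y | IsFirstMax y j}) (fun h => hF (hiff.1 h)) A
      rw [Set.indicator_apply, hBs, ite_self]
  change ∫⁻ y, A y ∂(pathLaw P' Y) = _
  rw [hsplit]
  simp_rw [hshift]
  have hmeas : ∀ j : ℤ, AEMeasurable ({y | IsFirstMax y 0}.indicator fun y =>
      h (toEllZero y) * (ENNReal.ofReal (ramp 1 (y (-j))) / rampSum y)) (pathLaw P' Y) := fun j =>
    ((hhm.mul ((hm (-j)).div hW)).indicator (measurableSet_isFirstMax 0)).aemeasurable
  rw [← lintegral_tsum hmeas, ← lintegral_indicator (measurableSet_isFirstMax 0)]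
  apply lintegral_congr_ae
  filter_upwards [h1, h0] with y hy1 hy0
  by_cases hF : IsFirstMax y 0
  · simp_rw [Set.indicator_of_mem (s := {y | IsFirstMax y 0}) hF]
    have hW0 : rampSum y ≠ 0 := by
      refine ((ENNReal.ofReal_pos.2 (ramp_pos_iff.2 hy1)).trans_le ?_).ne'
      exact ENNReal.le_tsum (f := fun l => ENNReal.ofReal (ramp 1 (y l))) 0
    have hWtop : rampSum y ≠ ∞ := by
      rw [rampSum, tsum_eq_sum (s := (finite_not_norm_lt hy0 one_pos).toFinset)]
      · exact (ENNReal.sum_lt_top.2 fun l _ => ENNReal.ofReal_lt_top).ne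
      · intro l hl
        have : ‖y l‖ < 1 := by simpa using hl
        simp [ramp_eq_zero this.le]
    rw [ENNReal.tsum_mul_left]
    simp_rw [div_eq_mul_inv]
    have hneg : ∑' j : ℤ, ENNReal.ofReal (ramp 1 (y (-j))) = rampSum y :=
      (Equiv.neg ℤ).tsum_eq fun l => ENNReal.ofReal (ramp 1 (y l))
    rw [ENNReal.tsum_mul_right, hneg, ENNReal.mul_inv_cancel hW0 hWtop, mul_one]
  · simp_rw [Set.indicator_of_notMem (s := {y | IsFirstMax y 0}) hF]
    exact tsum_zero

end ClusterMeasure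

section Sequences

variable {E : Type*} [NormedAddCommGroup E]

theorem infArgmax_eq_zero_iff_of_norm {y : ℤ → E} (h1 : 1 < ‖y 0‖)
    (h0 : Tendsto y cofinite (𝓝 0)) : infArgmax y = 0 ↔ IsFirstMax y 0 :=
  infArgmax_eq_zero_iff h0 (norm_pos_iff.1 (one_pos.trans h1))

variable [NormedSpace ℝ E]

theorem scaleShift_zero (t : ℝ) (y : ℤ → E) : scaleShift t 0 y = t • y := by
  ext l
  simp [scaleShift]

theorem measurable_const_smul_ellZero (c : ℝ) : Measurable fun x : C₀(ℤ, E) => c • x :=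
  (continuous_const_smul c).measurable

theorem infArgmax_spectral_eq_zero_iff {Ω' : Type*} {Y : ℤ → Ω' → E} {ω : Ω'} (h1 : 1 < ‖Y 0 ω‖)
    (h0 : Tendsto (fun j => Y j ω) cofinite (𝓝 0)) :
    infArgmax (spectral Y ω) = 0 ↔ IsFirstMax (fun j => Y j ω) 0 := by
  have hpos : 0 < ‖Y 0 ω‖ := one_pos.trans h1
  have hs : spectral Y ω = ‖Y 0 ω‖⁻¹ • fun j => Y j ω := rfl
  have h0' : Tendsto (spectral Y ω) cofinite (𝓝 0) := by
    have := h0.const_smul ‖Y 0 ω‖⁻¹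
    rwa [smul_zero] at this
  have hne : spectral Y ω 0 ≠ 0 :=
    smul_ne_zero (inv_pos.2 hpos).ne' (norm_pos_iff.1 hpos)
  rw [infArgmax_eq_zero_iff h0' hne, hs, isFirstMax_smul (inv_pos.2 hpos)]

end Sequences

/-! ### Integrals against the cluster measure. -/

section ClusterIntegrals

variable {E : Type*} [NormedAddCommGroup E] [NormedSpace ℝ E] [MeasurableSpace E]
  [BorelSpace E] [SecondCountableTopology E] {Ω : Type*} [MeasurableSpace Ω] {Ω' : Type*}
  [MeasurableSpace Ω'] {P : Measure Ω} {X : ℤ → Ω → E} {P' : Measure Ω'} {Y : ℤ → Ω' → E} {α : ℝ}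

theorem measurable_scaleShift (j : ℤ) :
    Measurable fun p : ℝ × (ℤ → E) => scaleShift p.1 j p.2 := by
  unfold scaleShift
  fun_prop

theorem measurable_smul_toEllZero :
    Measurable fun p : ℝ × (ℤ → E) => p.1 • toEllZero p.2 := by
  simp_rw [← toEllZero_smul, ← scaleShift_zero]
  exact measurable_toEllZero.comp (measurable_scaleShift 0)

/-- Integrals with respect to the cluster measure in terms of the law of the tail process. -/
theorem lintegral_clusterMeasure [IsProbabilityMeasure P'] (hY : ∀ j, Measurable (Y j))
    (h1 : ∀ᵐ ω ∂P', 1 < ‖Y 0 ω‖) (h0 : ∀ᵐ ω ∂P', Tendsto (fun j => Y j ω) cofinite (𝓝 0))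
    {F : C₀(ℤ, E) → ℝ≥0∞} (hF : Measurable F) :
    ∫⁻ x, F x ∂(clusterMeasure P' Y α) =
      ∫⁻ y in {y | IsFirstMax y 0}, ENNReal.ofReal (‖y 0‖ ^ (-α)) *
        ∫⁻ t, F (t • toEllZero y) ∂(radialMeasure α) ∂(pathLaw P' Y) := by
  have hsp : Measurable (spectral Y) := by
    refine measurable_pi_lambda _ fun j => ?_
    unfold spectral
    have := hY j
    have := hY 0
    fun_prop
  have hD : {ω | infArgmax (spectral Y ω) = 0} =ᵐ[P']
      (fun ω j => Y j ω) ⁻¹' {y | IsFirstMax y 0} := by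
    filter_upwards [h1, h0] with ω hω1 hω0
    exact propext (infArgmax_spectral_eq_zero_iff hω1 hω0)
  have hg : Measurable fun p : ℝ × Ω' => p.1 • toEllZero (spectral Y p.2) :=
    measurable_smul_toEllZero.comp (measurable_fst.prodMk (hsp.comp measurable_snd))
  have hK : Measurable fun y : ℤ → E => ENNReal.ofReal (‖y 0‖ ^ (-α)) *
      ∫⁻ t, F (t • toEllZero y) ∂(radialMeasure α) := by
    refine Measurable.mul ?_ ?_
    · have := measurable_pi_apply (X := fun _ : ℤ => E) 0
      fun_prop
    · exact (hF.comp measurable_smul_toEllZero).lintegral_prod_left'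
  have hFg : Measurable fun p : ℝ × Ω' => F (p.1 • toEllZero (spectral Y p.2)) := hF.comp hg
  rw [clusterMeasure, Measure.restrict_congr_set hD, lintegral_map hF hg,
    lintegral_prod_symm _ hFg.aemeasurable, pathLaw,
    setLIntegral_map (measurableSet_isFirstMax 0) hK (measurable_path hY)]
  refine lintegral_congr_ae (ae_restrict_of_ae ?_)
  filter_upwards [h1] with ω hω
  have hpos : 0 < ‖Y 0 ω‖ := one_pos.trans hω
  have hs : spectral Y ω = ‖Y 0 ω‖⁻¹ • fun j => Y j ω := rfl
  have hFm : Measurable fun t : ℝ => F (t • toEllZero fun j => Y j ω) :=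
    hF.comp (measurable_id.smul_const _)
  -- Homogeneity of the radial measure absorbs the normalization of `spectral` into the factor ‖Y
  -- 0‖^(-α).
  simp_rw [hs, toEllZero_smul, smul_smul, mul_comm _ ‖Y 0 ω‖⁻¹]
  rw [lintegral_radialMeasure_comp_mul α (inv_pos.2 hpos) hFm, Real.inv_rpow hpos.le,
    Real.rpow_neg hpos.le]

theorem lintegral_clusterMeasure_comp_smul [IsProbabilityMeasure P'] (hY : ∀ j, Measurable (Y j))
    (h1 : ∀ᵐ ω ∂P', 1 < ‖Y 0 ω‖) (h0 : ∀ᵐ ω ∂P', Tendsto (fun j => Y j ω) cofinite (𝓝 0))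
    {F : C₀(ℤ, E) → ℝ≥0∞} (hF : Measurable F) {c : ℝ} (hc : 0 < c) :
    ∫⁻ x, F (c • x) ∂(clusterMeasure P' Y α) =
      ENNReal.ofReal (c ^ α) * ∫⁻ x, F x ∂(clusterMeasure P' Y α) := by
  have hK : Measurable fun y : ℤ → E => ENNReal.ofReal (‖y 0‖ ^ (-α)) *
      ∫⁻ t, F (t • toEllZero y) ∂(radialMeasure α) := by
    refine Measurable.mul ?_ ?_
    · have := measurable_pi_apply (X := fun _ : ℤ => E) 0
      fun_prop
    · exact (hF.comp measurable_smul_toEllZero).lintegral_prod_left'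
  have hFc : Measurable fun x => F (c • x) := hF.comp (measurable_const_smul_ellZero c)
  rw [lintegral_clusterMeasure hY h1 h0 hF, lintegral_clusterMeasure hY h1 h0 hFc,
    ← lintegral_const_mul _ hK]
  refine lintegral_congr fun y => ?_
  have hFm : Measurable fun t : ℝ => F (t • toEllZero y) := hF.comp (measurable_id.smul_const _)
  rw [mul_left_comm, ← lintegral_radialMeasure_comp_mul α hc hFm]
  simp_rw [smul_smul]

/-- Each ray meets the unit sphere in at most one radius, and the radial measure has no atoms. -/
theorem clusterMeasure_norm_eq_one [IsProbabilityMeasure P'] (hY : ∀ j, Measurable (Y j))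
    (h1 : ∀ᵐ ω ∂P', 1 < ‖Y 0 ω‖) (h0 : ∀ᵐ ω ∂P', Tendsto (fun j => Y j ω) cofinite (𝓝 0)) :
    clusterMeasure P' Y α {x | ‖x‖ = 1} = 0 := by
  have hm : MeasurableSet {x : C₀(ℤ, E) | ‖x‖ = 1} :=
    measurableSet_eq_fun continuous_norm.measurable measurable_const
  rw [← lintegral_indicator_one hm,
    lintegral_clusterMeasure hY h1 h0 (measurable_one.indicator hm)]
  refine lintegral_eq_zero_of_ae_eq_zero (.of_forall fun y => ?_)
  have : ∫⁻ t, ({x : C₀(ℤ, E) | ‖x‖ = 1}).indicator 1 (t • toEllZero y) ∂(radialMeasure α) = 0 := by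
    refine lintegral_eq_zero_of_ae_eq_zero ?_
    have hne : ∀ᵐ t ∂(radialMeasure α), t ≠ ‖toEllZero y‖⁻¹ :=
      measure_eq_zero_iff_ae_notMem.1 (radialMeasure_singleton α _)
    filter_upwards [hne, ae_radialMeasure_pos α] with t ht ht0
    refine Set.indicator_of_notMem (fun h => ht ?_) _
    have h' : ‖t • toEllZero y‖ = 1 := h
    rw [norm_smul, Real.norm_eq_abs, abs_of_pos ht0] at h'
    exact eq_inv_of_mul_eq_one_left h'
  simp [this]

/-- Away from the unit ball, the cluster measure is the law of the tail process on the event that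
its first maximum is attained at zero. -/
theorem lintegral_clusterMeasure_of_support [IsProbabilityMeasure P] [IsProbabilityMeasure P']
    (hstat : IsStationary P X) (hRV : IsRegularlyVarying P X α) (hY : ∀ j, Measurable (Y j))
    (hXY : IsTailProcess P X P' Y)
    (h1 : ∀ᵐ ω ∂P', 1 < ‖Y 0 ω‖) (h0 : ∀ᵐ ω ∂P', Tendsto (fun j => Y j ω) cofinite (𝓝 0))
    {F : C₀(ℤ, E) → ℝ≥0∞} (hF : Measurable F) (hsupp : ∀ x, ‖x‖ ≤ 1 → F x = 0) :
    ∫⁻ x, F x ∂(clusterMeasure P' Y α) =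
      ∫⁻ y in {y | IsFirstMax y 0}, F (toEllZero y) ∂(pathLaw P' Y) := by
  have hprob : IsProbabilityMeasure (pathLaw P' Y) :=
    Measure.isProbabilityMeasure_map (measurable_path hY).aemeasurable
  have hn : Measurable fun y : ℤ → E => ‖y 0‖ := (measurable_pi_apply 0).norm
  have h1' : ∀ᵐ y ∂(pathLaw P' Y), 1 < ‖y 0‖ :=
    (ae_map_iff (measurable_path hY).aemeasurable (measurableSet_lt measurable_const hn)).2 h1
  have h0' : ∀ᵐ y ∂(pathLaw P' Y), Tendsto y cofinite (𝓝 0) :=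
    (ae_map_iff (measurable_path hY).aemeasurable measurableSet_tendsto_cofinite).2 h0
  -- Time change with j = 0 is applied for each radius t, with this K. As F vanishes on the unit
  -- ball and the norm of t • y is t‖y 0‖ when the first maximum is at 0, inserting the indicator of
  -- t‖y 0‖ > 1 costs nothing. After the time change the factor is t^(2α) on t < ‖y 0‖, and the
  -- integral over t yields ‖y 0‖^α.
  let K : (ℤ → E) → ℝ≥0∞ := {y | IsFirstMax y 0}.indicator
    fun y => ENNReal.ofReal (‖y 0‖ ^ (-α)) * F (toEllZero y)
  have hK : Measurable K := Measurable.indicator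
    ((by fun_prop : Measurable fun y : ℤ → E => ENNReal.ofReal (‖y 0‖ ^ (-α))).mul
      (hF.comp measurable_toEllZero)) (measurableSet_isFirstMax 0)
  let G : ℝ × (ℤ → E) → ℝ≥0∞ := fun p => ENNReal.ofReal (p.1 ^ α) *
    {y : ℤ → E | 1 < ‖y 0‖}.indicator K (scaleShift p.1 0 p.2)
  have hG : Measurable G :=
    (by fun_prop : Measurable fun p : ℝ × (ℤ → E) => ENNReal.ofReal (p.1 ^ α)).mul
      ((hK.indicator (measurableSet_lt measurable_const hn)).comp (measurable_scaleShift 0))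
  let G' : ℝ × (ℤ → E) → ℝ≥0∞ := fun p => ENNReal.ofReal (p.1 ^ (2 * α)) *
    {p : ℝ × (ℤ → E) | p.1 < ‖p.2 0‖}.indicator (fun p => K p.2) p
  have hG' : Measurable G' :=
    (by fun_prop : Measurable fun p : ℝ × (ℤ → E) => ENNReal.ofReal (p.1 ^ (2 * α))).mul
      ((hK.comp measurable_snd).indicator (measurableSet_lt measurable_fst (hn.comp measurable_snd)))
  have e1 : ∫⁻ x, F x ∂(clusterMeasure P' Y α) =
      ∫⁻ y, ∫⁻ t, G (t, y) ∂(radialMeasure α) ∂(pathLaw P' Y) := by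
    rw [lintegral_clusterMeasure hY h1 h0 hF, ← lintegral_indicator (measurableSet_isFirstMax 0)]
    refine lintegral_congr_ae ?_
    filter_upwards [h1', h0'] with y hy1 hy0
    have hpos : 0 < ‖y 0‖ := one_pos.trans hy1
    by_cases hD : IsFirstMax y 0
    · have hFm : Measurable fun t : ℝ => F (t • toEllZero y) :=
        hF.comp (measurable_id.smul_const _)
      rw [Set.indicator_of_mem (s := {y | IsFirstMax y 0}) hD, ← lintegral_const_mul _ hFm]
      refine lintegral_congr_ae ?_
      filter_upwards [ae_radialMeasure_pos α] with t ht
      have hty : ‖(t • y) 0‖ = t * ‖y 0‖ := by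
        rw [Pi.smul_apply, norm_smul, Real.norm_eq_abs, abs_of_pos ht]
      have hKt : K (t • y) = ENNReal.ofReal ((t * ‖y 0‖) ^ (-α)) * F (t • toEllZero y) := by
        refine (Set.indicator_of_mem (s := {y | IsFirstMax y 0})
          ((isFirstMax_smul ht y 0).2 hD) _).trans ?_
        rw [hty, toEllZero_smul]
      simp only [G, scaleShift_zero]
      by_cases h : 1 < ‖(t • y) 0‖
      · rw [Set.indicator_of_mem (s := {y : ℤ → E | 1 < ‖y 0‖}) h, hKt, ← mul_assoc,
          ← ENNReal.ofReal_mul (by positivity), Real.mul_rpow ht.le hpos.le, ← mul_assoc,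
          ← Real.rpow_add ht]
        simp
      · rw [Set.indicator_of_notMem (s := {y : ℤ → E | 1 < ‖y 0‖}) h, hsupp, mul_zero, mul_zero]
        rw [norm_smul, Real.norm_eq_abs, abs_of_pos ht, norm_toEllZero_of_isFirstMax hy0 hD, ← hty]
        exact not_lt.1 h
    · rw [Set.indicator_of_notMem (s := {y | IsFirstMax y 0}) hD]
      symm
      refine lintegral_eq_zero_of_ae_eq_zero ?_
      filter_upwards [ae_radialMeasure_pos α] with t ht
      have : K (t • y) = 0 := Set.indicator_of_notMem (s := {y | IsFirstMax y 0})
        (fun h => hD ((isFirstMax_smul ht y 0).1 h)) _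
      simp [G, scaleShift_zero, Set.indicator_apply, this]
  have e2 : ∫⁻ t, ∫⁻ y, G (t, y) ∂(pathLaw P' Y) ∂(radialMeasure α) =
      ∫⁻ t, ∫⁻ y, G' (t, y) ∂(pathLaw P' Y) ∂(radialMeasure α) := by
    refine lintegral_congr_ae ?_
    filter_upwards [ae_radialMeasure_pos α] with t ht
    have htc := lintegral_timeChange hstat hRV hY hXY h1' hK ht 0
    simp only [G, G']
    rw [lintegral_const_mul' _ _ ENNReal.ofReal_ne_top, lintegral_const_mul' _ _ ENNReal.ofReal_ne_top]
    have : ∀ y : ℤ → E, {p : ℝ × (ℤ → E) | p.1 < ‖p.2 0‖}.indicator (fun p => K p.2) (t, y) =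
        {y : ℤ → E | t < ‖y 0‖}.indicator K y := fun y => rfl
    simp_rw [this]
    rw [htc, ← mul_assoc, ← ENNReal.ofReal_mul (by positivity), ← Real.rpow_add ht]
    congr 3
    ring
  have e3 : ∫⁻ y, ∫⁻ t, G' (t, y) ∂(radialMeasure α) ∂(pathLaw P' Y) =
      ∫⁻ y in {y | IsFirstMax y 0}, F (toEllZero y) ∂(pathLaw P' Y) := by
    rw [← lintegral_indicator (measurableSet_isFirstMax 0)]
    refine lintegral_congr_ae ?_
    filter_upwards [h1'] with y hy1
    have hpos : 0 < ‖y 0‖ := one_pos.trans hy1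
    have hpt : ∀ t, G' (t, y) =
        (ENNReal.ofReal (t ^ (2 * α)) * (Set.Iio ‖y 0‖).indicator 1 t) * K y := by
      intro t
      simp only [G', mul_assoc]
      congr 1
      by_cases h : t < ‖y 0‖
      · rw [Set.indicator_of_mem (by exact h), Set.indicator_of_mem (by exact h), Pi.one_apply,
          one_mul]
      · rw [Set.indicator_of_notMem (by exact h), Set.indicator_of_notMem (by exact h), zero_mul]
    simp_rw [hpt]
    have hpow : Measurable fun t : ℝ =>
        ENNReal.ofReal (t ^ (2 * α)) * (Set.Iio ‖y 0‖).indicator 1 t :=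
      (by fun_prop : Measurable fun t : ℝ => ENNReal.ofReal (t ^ (2 * α))).mul
        (measurable_one.indicator measurableSet_Iio)
    rw [lintegral_mul_const _ hpow, lintegral_radialMeasure_pow hRV.index_pos hpos]
    by_cases hD : IsFirstMax y 0
    · rw [Set.indicator_of_mem (s := {y | IsFirstMax y 0}) hD]
      simp only [K]
      rw [Set.indicator_of_mem (s := {y | IsFirstMax y 0}) hD, ← mul_assoc,
        ← ENNReal.ofReal_mul (by positivity), ← Real.rpow_add hpos]
      simp
    · simp [K, Set.indicator_of_notMem (s := {y | IsFirstMax y 0}) hD]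
  rw [e1, ← lintegral_prod_symm _ hG.aemeasurable, lintegral_prod _ hG.aemeasurable, e2,
    ← lintegral_prod _ hG'.aemeasurable, lintegral_prod_symm _ hG'.aemeasurable, e3]

theorem clusterMeasure_norm_ge_lt_top [IsProbabilityMeasure P] [IsProbabilityMeasure P']
    (hstat : IsStationary P X) (hRV : IsRegularlyVarying P X α) (hY : ∀ j, Measurable (Y j))
    (hXY : IsTailProcess P X P' Y)
    (h1 : ∀ᵐ ω ∂P', 1 < ‖Y 0 ω‖) (h0 : ∀ᵐ ω ∂P', Tendsto (fun j => Y j ω) cofinite (𝓝 0))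
    {ε : ℝ} (hε : 0 < ε) : clusterMeasure P' Y α {x | ε ≤ ‖x‖} < ∞ := by
  have hprob : IsProbabilityMeasure (pathLaw P' Y) :=
    Measure.isProbabilityMeasure_map (measurable_path hY).aemeasurable
  have hm : ∀ c : ℝ, MeasurableSet {x : C₀(ℤ, E) | c ≤ ‖x‖} := fun c =>
    measurableSet_le measurable_const continuous_norm.measurable
  -- The set is rescaled to ‖x‖ ≥ 2 and not ‖x‖ ≥ 1, because the indicator has to vanish on the
  -- closed unit ball.
  have hc : 0 < 2 / ε := by positivity
  have hF : Measurable ({x : C₀(ℤ, E) | 2 ≤ ‖x‖}.indicator (1 : C₀(ℤ, E) → ℝ≥0∞)) :=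
    measurable_one.indicator (hm 2)
  have e : ∫⁻ x, {x : C₀(ℤ, E) | 2 ≤ ‖x‖}.indicator 1 ((2 / ε) • x) ∂(clusterMeasure P' Y α) =
      clusterMeasure P' Y α {x | ε ≤ ‖x‖} := by
    rw [← lintegral_indicator_one (hm ε)]
    refine lintegral_congr fun x => ?_
    have hiff : 2 ≤ ‖(2 / ε) • x‖ ↔ ε ≤ ‖x‖ := by
      rw [norm_smul, Real.norm_eq_abs, abs_of_pos hc, div_mul_eq_mul_div, le_div_iff₀ hε,
        mul_le_mul_iff_right₀ two_pos]
    simp only [Set.indicator_apply, Set.mem_ofPred_eq, hiff, Pi.one_apply]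
  rw [← e, lintegral_clusterMeasure_comp_smul hY h1 h0 hF hc,
    lintegral_clusterMeasure_of_support hstat hRV hY hXY h1 h0 hF]
  · refine ENNReal.mul_lt_top ENNReal.ofReal_lt_top ?_
    refine (lintegral_mono (g := 1) fun y => ?_).trans_lt ?_
    · exact Set.indicator_le_self' (by simp) _
    · simp [measure_lt_top]
  · intro x hx
    refine Set.indicator_of_notMem (fun h => ?_) _
    have h' : 2 ≤ ‖x‖ := h
    linarith

end ClusterIntegrals

/-! ### Sharing a functional among the exceedances. -/

section Anchor

variable {E : Type*} [NormedAddCommGroup E]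

/-- Shift-invariant nonnegative bounded Lipschitz functionals which vanish on the unit ball. -/
structure IsLipschitzTest (H : C₀(ℤ, E) → ℝ) (K : NNReal) (C : ℝ) : Prop where
  lipschitz : LipschitzWith K H
  nonneg : ∀ x, 0 ≤ H x
  le : ∀ x, H x ≤ C
  shift_invariant : ∀ (k : ℤ) (x : C₀(ℤ, E)), H (shift k x) = H x
  eq_zero : ∀ x : C₀(ℤ, E), ‖x‖ ≤ 1 → H x = 0

/-- A functional of a finite window, weighted by the share of the coordinate `0` in the
exceedances of level one. -/
noncomputable def anchored (H : C₀(ℤ, E) → ℝ) (a b : ℤ) (y : ℤ → E) : ℝ :=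
  H (window a b y) * (ramp 1 (y 0) / ∑ i ∈ Finset.Icc a b, ramp 1 (y i))

theorem sum_ramp_nonneg (S : Finset ℤ) (y : ℤ → E) : 0 ≤ ∑ i ∈ S, ramp 1 (y i) :=
  Finset.sum_nonneg fun _ _ => ramp_nonneg _ _

theorem ramp_div_sum_nonneg (S : Finset ℤ) (y : ℤ → E) :
    0 ≤ ramp 1 (y 0) / ∑ i ∈ S, ramp 1 (y i) :=
  div_nonneg (ramp_nonneg _ _) (sum_ramp_nonneg _ _)

theorem ramp_div_sum_le_one {S : Finset ℤ} (hS : 0 ∈ S) (y : ℤ → E) :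
    ramp 1 (y 0) / ∑ i ∈ S, ramp 1 (y i) ≤ 1 :=
  div_le_one_of_le₀
    (Finset.single_le_sum (f := fun i => ramp 1 (y i)) (fun _ _ => ramp_nonneg _ _) hS)
    (sum_ramp_nonneg _ _)

variable {H : C₀(ℤ, E) → ℝ} {K : NNReal} {C : ℝ}

theorem anchored_eq_zero {a b : ℤ} {y : ℤ → E} (hy : ‖y 0‖ ≤ 1) : anchored H a b y = 0 := by
  simp [anchored, ramp_eq_zero hy]

/-- The denominator in `anchored` can vanish only where H does, so the convention 0/0 = 0 is
harmless. -/
theorem IsLipschitzTest.sum_ramp_pos (hH : IsLipschitzTest H K C) {a b : ℤ} {y : ℤ → E}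
    (hy : H (window a b y) ≠ 0) : 0 < ∑ i ∈ Finset.Icc a b, ramp 1 (y i) := by
  have h1 : 1 < ‖window a b y‖ := by
    by_contra! h
    exact hy (hH.eq_zero _ h)
  obtain ⟨l, hl⟩ := (lt_norm_iff zero_le_one).1 h1
  rw [window_apply] at hl
  split_ifs at hl with hlab
  · exact (ramp_pos_iff.2 hl).trans_le
      (Finset.single_le_sum (f := fun i => ramp 1 (y i)) (fun _ _ => ramp_nonneg _ _)
        (Finset.mem_Icc.2 hlab))
  · rw [norm_zero] at hl
    linarith

theorem IsLipschitzTest.anchored_nonneg (hH : IsLipschitzTest H K C) (a b : ℤ) (y : ℤ → E) :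
    0 ≤ anchored H a b y :=
  mul_nonneg (hH.nonneg _) (ramp_div_sum_nonneg _ _)

theorem IsLipschitzTest.anchored_le_apply (hH : IsLipschitzTest H K C) {a b : ℤ} (ha : a ≤ 0)
    (hb : 0 ≤ b) (y : ℤ → E) : anchored H a b y ≤ H (window a b y) :=
  mul_le_of_le_one_right (hH.nonneg _) (ramp_div_sum_le_one (Finset.mem_Icc.2 ⟨ha, hb⟩) _)

theorem IsLipschitzTest.anchored_le (hH : IsLipschitzTest H K C) {a b : ℤ} (ha : a ≤ 0)
    (hb : 0 ≤ b) (y : ℤ → E) : anchored H a b y ≤ C :=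
  (hH.anchored_le_apply ha hb y).trans (hH.le _)

theorem IsLipschitzTest.abs_anchored_le (hH : IsLipschitzTest H K C) {a b : ℤ} (ha : a ≤ 0)
    (hb : 0 ≤ b) (y : ℤ → E) : |anchored H a b y| ≤ C := by
  rw [abs_of_nonneg (hH.anchored_nonneg a b y)]
  exact hH.anchored_le ha hb y

/-- The quotient may be discontinuous where its denominator is 0, but there H = 0, and `anchored` is
squeezed between 0 and the continuous H. -/
theorem IsLipschitzTest.continuous_anchored (hH : IsLipschitzTest H K C) {a b : ℤ} (ha : a ≤ 0)
    (hb : 0 ≤ b) : Continuous (anchored H a b) := by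
  have hc : Continuous fun y : ℤ → E => H (window a b y) :=
    hH.lipschitz.continuous.comp (continuous_window a b)
  have hr : ∀ l : ℤ, Continuous fun y : ℤ → E => ramp 1 (y l) := fun l =>
    (continuous_ramp 1).comp (continuous_apply l)
  rw [continuous_iff_continuousAt]
  intro y
  by_cases hy : H (window a b y) = 0
  · have h0 : anchored H a b y = 0 := by rw [anchored, hy, zero_mul]
    rw [ContinuousAt, h0]
    have := hc.tendsto y
    rw [hy] at this
    exact squeeze_zero (hH.anchored_nonneg a b) (hH.anchored_le_apply ha hb) this
  · exact hc.continuousAt.mul ((hr 0).continuousAt.div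
      (continuous_finsetSum _ fun l _ => hr l).continuousAt (hH.sum_ramp_pos hy).ne')

theorem dependsOn_anchored (H : C₀(ℤ, E) → ℝ) (k : ℕ) :
    DependsOn (anchored H (-(k : ℤ)) k) (Set.Icc (-(k : ℤ)) k) := by
  intro y z h
  have h1 : window (-(k : ℤ)) k y = window (-(k : ℤ)) k z := by
    ext l
    rw [window_apply, window_apply]
    split_ifs with hl
    · exact h l hl
    · rfl
  have h2 : ∑ i ∈ Finset.Icc (-(k : ℤ)) k, ramp 1 (y i) =
      ∑ i ∈ Finset.Icc (-(k : ℤ)) k, ramp 1 (z i) :=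
    Finset.sum_congr rfl fun i hi => by rw [h i (Finset.mem_Icc.1 hi)]
  rw [anchored, anchored, h1, h2, h 0 ⟨by omega, by omega⟩]

/-- Enlarging the window beyond which the sequence is small changes the anchored functional
only little. -/
theorem IsLipschitzTest.abs_anchored_sub_le (hH : IsLipschitzTest H K C) {a b : ℤ} {k : ℕ}
    (ha : a ≤ -(k : ℤ)) (hb : (k : ℤ) ≤ b) {η : ℝ} (hη0 : 0 ≤ η) (hη1 : η ≤ 1) {y : ℤ → E}
    (hy : ∀ i, a ≤ i → i ≤ b → (k : ℤ) < |i| → ‖y i‖ ≤ η) :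
    |anchored H a b y - anchored H (-(k : ℤ)) k y| ≤ K * η := by
  -- The added coordinates have norm at most η ≤ 1 and get weight 0, so the share is unchanged and
  -- only H moves.
  have hsum : ∑ i ∈ Finset.Icc (-(k : ℤ)) k, ramp 1 (y i) =
      ∑ i ∈ Finset.Icc a b, ramp 1 (y i) := by
    refine Finset.sum_subset (Finset.Icc_subset_Icc ha hb) fun i hi hik => ?_
    rw [Finset.mem_Icc, ← abs_le, not_le] at hik
    obtain ⟨h1, h2⟩ := Finset.mem_Icc.1 hi
    exact ramp_eq_zero ((hy i h1 h2 hik).trans hη1)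
  have hdist : ‖window a b y - window (-(k : ℤ)) k y‖ ≤ η := by
    refine (norm_sub_le_iff hη0).2 fun l => ?_
    rw [window_apply, window_apply]
    by_cases h1 : -(k : ℤ) ≤ l ∧ l ≤ k
    · rw [if_pos h1, if_pos ⟨ha.trans h1.1, h1.2.trans hb⟩, sub_self, norm_zero]
      exact hη0
    · rw [if_neg h1, sub_zero]
      split_ifs with h2
      · rw [← abs_le, not_le] at h1
        exact hy l h2.1 h2.2 h1
      · rwa [norm_zero]
  rw [anchored, anchored, hsum, ← sub_mul, abs_mul, abs_of_nonneg (ramp_div_sum_nonneg _ _)]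
  have hlip := hH.lipschitz.dist_le_mul (window a b y) (window (-(k : ℤ)) k y)
  rw [Real.dist_eq, dist_eq_norm] at hlip
  refine (mul_le_of_le_one_right (abs_nonneg _)
    (ramp_div_sum_le_one (Finset.mem_Icc.2 ⟨by omega, by omega⟩) y)).trans ?_
  exact hlip.trans (mul_le_mul_of_nonneg_left hdist K.2)

/-- The term of j is H times the weight of coordinate j in the block: recentring at j leaves H
unchanged by shift invariance. The weights sum to 1 wherever H ≠ 0. -/
theorem IsLipschitzTest.apply_window_eq_sum (hH : IsLipschitzTest H K C) (r : ℤ) (y : ℤ → E) :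
    H (window 1 r y) = ∑ j ∈ Finset.Icc 1 r, anchored H (1 - j) (r - j) fun l => y (l + j) := by
  have hterm : ∀ j, anchored H (1 - j) (r - j) (fun l => y (l + j)) =
      H (window 1 r y) * (ramp 1 (y j) / ∑ i ∈ Finset.Icc 1 r, ramp 1 (y i)) := by
    intro j
    have h1 : window (1 - j) (r - j) (fun l => y (l + j)) = shift (-j) (window 1 r y) := by
      have := window_shift 1 r (-j) y
      simpa [← sub_eq_add_neg] using this
    have h2 : ∑ i ∈ Finset.Icc (1 - j) (r - j), ramp 1 (y (i + j)) =
        ∑ i ∈ Finset.Icc 1 r, ramp 1 (y i) := by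
      refine Finset.sum_nbij' (· + j) (· - j) ?_ ?_ (by simp) (by simp) (by simp) <;>
      · intro i hi
        rw [Finset.mem_Icc] at hi ⊢
        omega
    rw [anchored, h1, hH.shift_invariant, h2, zero_add]
  simp_rw [hterm]
  by_cases h0 : H (window 1 r y) = 0
  · simp [h0]
  · rw [← Finset.mul_sum, ← Finset.sum_div, div_self (hH.sum_ramp_pos h0).ne', mul_one]

end Anchor

theorem measurableSet_exceedance {E Ω : Type*} [NormedAddCommGroup E] [MeasurableSpace E]
    [BorelSpace E] [MeasurableSpace Ω] {X : ℤ → Ω → E}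
    (hX : ∀ j, Measurable (X j)) (p : ℤ → Prop) (c : ℝ) :
    MeasurableSet {ω | ∃ j : ℤ, p j ∧ c < ‖X j ω‖} := by
  have : {ω | ∃ j : ℤ, p j ∧ c < ‖X j ω‖} = ⋃ j : ℤ, {ω | p j ∧ c < ‖X j ω‖} := by
    ext ω
    simp
  rw [this]
  exact MeasurableSet.iUnion fun j =>
    (MeasurableSet.const _).inter (measurableSet_lt measurable_const (hX j).norm)

/-! ### Block limits for Lipschitz functionals vanishing on the unit ball. -/

section Convergence

variable {E : Type*} [NormedAddCommGroup E] [NormedSpace ℝ E] [MeasurableSpace E]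
  [BorelSpace E] [SecondCountableTopology E] {Ω : Type*} [MeasurableSpace Ω] {Ω' : Type*}
  [MeasurableSpace Ω'] {P : Measure Ω} {X : ℤ → Ω → E} {P' : Measure Ω'} {Y : ℤ → Ω' → E} {α : ℝ}
  {H : C₀(ℤ, E) → ℝ} {K : NNReal} {C : ℝ}

theorem IsLipschitzTest.tendsto_integral_anchored [IsProbabilityMeasure P]
    [IsProbabilityMeasure P'] (hstat : IsStationary P X)
    (hRV : IsRegularlyVarying P X α) (hY : ∀ j, Measurable (Y j))
    (hXY : IsTailProcess P X P' Y) (h1 : ∀ᵐ y ∂(pathLaw P' Y), 1 < ‖y 0‖)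
    (h0 : ∀ᵐ y ∂(pathLaw P' Y), Tendsto y cofinite (𝓝 0)) (hH : IsLipschitzTest H K C) :
    Tendsto (fun k : ℕ => ∫ y, anchored H (-(k : ℤ)) k y ∂(pathLaw P' Y)) atTop
      (𝓝 (∫ y in {y | IsFirstMax y 0}, H (toEllZero y) ∂(pathLaw P' Y))) := by
  have hprob : IsProbabilityMeasure (pathLaw P' Y) :=
    Measure.isProbabilityMeasure_map (measurable_path hY).aemeasurable
  have hHm : Measurable fun y : ℤ → E => H (toEllZero y) :=
    hH.lipschitz.continuous.measurable.comp measurable_toEllZero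
  have hm : ∀ l : ℤ, Measurable fun y : ℤ → E => ENNReal.ofReal (ramp 1 (y l)) := fun l =>
    ((continuous_ramp 1).comp (continuous_apply l)).measurable.ennreal_ofReal
  have hW : Measurable (rampSum : (ℤ → E) → ℝ≥0∞) := Measurable.tsum hm
  let g : (ℤ → E) → ℝ := fun y =>
    H (toEllZero y) * (ENNReal.ofReal (ramp 1 (y 0)) / rampSum y).toReal
  have hg : Measurable g := hHm.mul ((hm 0).div hW).ennreal_toReal
  have hlim : Tendsto (fun k : ℕ => ∫ y, anchored H (-(k : ℤ)) k y ∂(pathLaw P' Y)) atTop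
      (𝓝 (∫ y, g y ∂(pathLaw P' Y))) := by
    refine tendsto_integral_of_dominated_convergence (fun _ => C) (fun k =>
      (hH.continuous_anchored (by omega) (by omega)).aestronglyMeasurable) (integrable_const _)
      (fun k => .of_forall fun y => hH.abs_anchored_le (by omega) (by omega) y) ?_
    filter_upwards [h0] with y hy
    have hfin := finite_not_norm_lt hy one_pos
    obtain ⟨N, hN⟩ : ∃ N : ℕ, ∀ l ∈ {l : ℤ | ¬ ‖y l‖ < 1}, l.natAbs ≤ N := by
      obtain ⟨N, hN⟩ := (hfin.image Int.natAbs).bddAbove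
      exact ⟨N, fun l hl => hN ⟨l, hl, rfl⟩⟩
    refine ((hH.lipschitz.continuous.tendsto _).comp (tendsto_window hy)).mul
      (tendsto_const_nhds.congr' ?_)
    -- Only finitely many coordinates reach norm 1, so the share is constant in k from some point
    -- on.
    filter_upwards [eventually_ge_atTop N] with k hk
    have hs : rampSum y = ENNReal.ofReal (∑ i ∈ Finset.Icc (-(k : ℤ)) k, ramp 1 (y i)) := by
      rw [ENNReal.ofReal_sum_of_nonneg fun _ _ => ramp_nonneg _ _]
      refine tsum_eq_sum fun l hl => ?_
      rw [ramp_eq_zero, ENNReal.ofReal_zero]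
      by_contra! hl1
      have := hN l (not_lt.2 hl1.le)
      exact hl (Finset.mem_Icc.2 ⟨by omega, by omega⟩)
    rw [hs, ENNReal.toReal_div, ENNReal.toReal_ofReal (ramp_nonneg _ _),
      ENNReal.toReal_ofReal (sum_ramp_nonneg _ _)]
  have heq : ∫ y, g y ∂(pathLaw P' Y) =
      ∫ y in {y | IsFirstMax y 0}, H (toEllZero y) ∂(pathLaw P' Y) := by
    rw [integral_eq_lintegral_of_nonneg_ae (.of_forall fun y =>
        mul_nonneg (hH.nonneg _) ENNReal.toReal_nonneg) hg.aestronglyMeasurable,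
      integral_eq_lintegral_of_nonneg_ae (.of_forall fun y => hH.nonneg _)
        hHm.aestronglyMeasurable,
      ← lintegral_rampSum_anchor hstat hRV hY hXY h1 h0
        hH.lipschitz.continuous.measurable.ennreal_ofReal
        fun k x => by rw [hH.shift_invariant]]
    congr 1
    refine lintegral_congr_ae ?_
    filter_upwards [h1] with y hy
    have hW0 : rampSum y ≠ 0 := by
      refine ((ENNReal.ofReal_pos.2 (ramp_pos_iff.2 hy)).trans_le ?_).ne'
      exact ENNReal.le_tsum (f := fun l => ENNReal.ofReal (ramp 1 (y l))) 0
    rw [ENNReal.ofReal_mul (hH.nonneg _),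
      ENNReal.ofReal_toReal (ENNReal.div_ne_top ENNReal.ofReal_ne_top hW0)]
  rwa [heq] at hlim

theorem measurable_block (hX : ∀ j, Measurable (X j)) (r : ℕ) (u : ℝ) :
    Measurable (block X r u) :=
  (measurable_window 1 (r : ℤ)).comp (measurable_pi_lambda _ fun j => (hX j).const_smul u⁻¹)

/-- The normalized mean of a block functional as an average of anchored functionals. -/
theorem IsLipschitzTest.integral_block_eq_sum [IsProbabilityMeasure P] (hX : ∀ j, Measurable (X j))
    (hstat : IsStationary P X) (hH : IsLipschitzTest H K C) (r : ℕ) {u : ℝ} (hu : 0 < u) :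
    (∫ ω, H (block X r u ω) ∂P) / ((r : ℝ) * P.real {ω | u < ‖X 0 ω‖}) =
      (∑ j ∈ Finset.Icc 1 (r : ℤ), ∫ ω, anchored H (1 - j) (r - j) (fun l => u⁻¹ • X l ω)
        ∂(P[|{ω | u < ‖X 0 ω‖}])) / r := by
  have hcont : ∀ j ∈ Finset.Icc 1 (r : ℤ), Continuous (anchored H (1 - j) (r - j)) := by
    intro j hj
    obtain ⟨h1, h2⟩ := Finset.mem_Icc.1 hj
    exact hH.continuous_anchored (by omega) (by omega)
  have hscale : Continuous fun y : ℤ → E => fun l => u⁻¹ • y l := by fun_prop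
  have hint : ∀ j ∈ Finset.Icc 1 (r : ℤ), Integrable (fun ω =>
      anchored H (1 - j) (r - j) fun l => u⁻¹ • X (l + j) ω) P := by
    intro j hj
    obtain ⟨h1, h2⟩ := Finset.mem_Icc.1 hj
    refine Integrable.of_bound (C := C) ?_ (.of_forall fun ω =>
      hH.abs_anchored_le (by omega) (by omega) _)
    exact ((hcont j hj).measurable.comp (measurable_pi_lambda _ fun l =>
      (hX (l + j)).const_smul u⁻¹)).aestronglyMeasurable
  have h1 : ∫ ω, H (block X r u ω) ∂P = ∑ j ∈ Finset.Icc 1 (r : ℤ),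
      ∫ ω, anchored H (1 - j) (r - j) (fun l => u⁻¹ • X l ω) ∂P := by
    have : ∀ ω, H (block X r u ω) = ∑ j ∈ Finset.Icc 1 (r : ℤ),
        anchored H (1 - j) (r - j) fun l => u⁻¹ • X (l + j) ω := fun ω =>
      hH.apply_window_eq_sum (r : ℤ) fun l => u⁻¹ • X l ω
    simp_rw [this]
    rw [integral_finsetSum _ hint]
    refine Finset.sum_congr rfl fun j hj => ?_
    exact hstat.integral_shift ((hcont j hj).comp hscale).measurable j
  rw [h1, mul_comm, ← div_div, Finset.sum_div]
  congr 1
  refine Finset.sum_congr rfl fun j hj => (integral_cond_eq _ fun ω hω => ?_).symm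
  apply anchored_eq_zero
  rw [norm_smul, norm_inv, Real.norm_eq_abs, abs_of_pos hu, inv_mul_le_iff₀ hu, mul_one]
  exact not_lt.1 hω

/-- The three errors: K η from coordinates of norm at most η beyond k; C on the event of a larger
value there; C for each of the at most 2k indices j whose window does not contain [-k, k]. -/
theorem IsLipschitzTest.abs_sub_integral_anchored_le [IsProbabilityMeasure P]
    (hX : ∀ j, Measurable (X j)) (hstat : IsStationary P X) (hRV : IsRegularlyVarying P X α)
    (hH : IsLipschitzTest H K C) {r : ℕ} (hr : 0 < r) {u : ℝ} (hu : 0 < u) (k : ℕ) {η : ℝ}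
    (hη0 : 0 < η) (hη1 : η ≤ 1) :
    |(∫ ω, H (block X r u ω) ∂P) / ((r : ℝ) * P.real {ω | u < ‖X 0 ω‖}) -
      ∫ ω, anchored H (-(k : ℤ)) k (fun l => u⁻¹ • X l ω) ∂(P[|{ω | u < ‖X 0 ω‖}])| ≤
    K * η + C * (P[|{ω | u < ‖X 0 ω‖}]).real
      {ω | ∃ j : ℤ, ((k : ℤ) ≤ |j| ∧ |j| ≤ (r : ℤ)) ∧ u * η < ‖X j ω‖} + C * (2 * k) / r := by
  have hprob := isProbabilityMeasure_cond_tail hRV u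
  set Q := P[|{ω | u < ‖X 0 ω‖}] with hQ
  set A := {ω | ∃ j : ℤ, ((k : ℤ) ≤ |j| ∧ |j| ≤ (r : ℤ)) ∧ u * η < ‖X j ω‖} with hA
  have hAm : MeasurableSet A := measurableSet_exceedance hX _ _
  have hC : 0 ≤ C := (hH.nonneg 0).trans (hH.le 0)
  have hrpos : (0 : ℝ) < r := by exact_mod_cast hr
  have hint : ∀ {a b : ℤ}, a ≤ 0 → 0 ≤ b →
      Integrable (fun ω => anchored H a b fun l => u⁻¹ • X l ω) Q := by
    intro a b ha hb
    refine Integrable.of_bound (C := C) ?_ (.of_forall fun ω => hH.abs_anchored_le ha hb _)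
    exact ((hH.continuous_anchored ha hb).measurable.comp (measurable_pi_lambda _ fun l =>
      (hX l).const_smul u⁻¹)).aestronglyMeasurable
  set b := ∫ ω, anchored H (-(k : ℤ)) k (fun l => u⁻¹ • X l ω) ∂Q with hb
  have habs : ∀ {s t : ℝ}, 0 ≤ s → s ≤ C → 0 ≤ t → t ≤ C → |s - t| ≤ C := by
    intro s t hs hsC ht htC
    rw [abs_le]
    constructor <;> linarith
  -- For j outside T, 1 - j ≤ -k and k ≤ r - j.
  let T : Finset ℤ := Finset.Icc 1 (k : ℤ) ∪ Finset.Ioc ((r : ℤ) - k) r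
  have hterm : ∀ j ∈ Finset.Icc 1 (r : ℤ),
      |(∫ ω, anchored H (1 - j) (r - j) (fun l => u⁻¹ • X l ω) ∂Q) - b| ≤
        (K * η + C * Q.real A) + if j ∈ T then C else 0 := by
    intro j hj
    obtain ⟨hj1, hj2⟩ := Finset.mem_Icc.1 hj
    rw [hb, ← integral_sub (hint (by omega) (by omega)) (hint (by omega) (by omega))]
    by_cases hjT : j ∈ T
    · rw [if_pos hjT]
      have hle : |∫ ω, (anchored H (1 - j) (r - j) (fun l => u⁻¹ • X l ω) -
          anchored H (-(k : ℤ)) k (fun l => u⁻¹ • X l ω)) ∂Q| ≤ C := by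
        have := norm_integral_le_of_norm_le_const (μ := Q) (C := C)
          (f := fun ω => anchored H (1 - j) (r - j) (fun l => u⁻¹ • X l ω) -
            anchored H (-(k : ℤ)) k (fun l => u⁻¹ • X l ω))
          (.of_forall fun ω => habs (hH.anchored_nonneg _ _ _)
            (hH.anchored_le (by omega) (by omega) _) (hH.anchored_nonneg _ _ _)
            (hH.anchored_le (by omega) (by omega) _))
        simpa using this
      have h1 : 0 ≤ K * η := by positivity
      have h2 : 0 ≤ C * Q.real A := by positivity
      linarith
    · rw [if_neg hjT, add_zero]
      simp only [T, Finset.mem_union, Finset.mem_Icc, Finset.mem_Ioc, not_or] at hjT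
      refine (abs_integral_le_integral_abs).trans ?_
      have hbd : ∫ ω, (K * η + A.indicator (fun _ => C) ω) ∂Q = K * η + C * Q.real A := by
        rw [integral_add (integrable_const _) ((integrable_const C).indicator hAm),
          integral_indicator_const C hAm]
        simp [mul_comm]
      rw [← hbd]
      refine integral_mono_of_nonneg (.of_forall fun ω => abs_nonneg _)
        ((integrable_const _).add ((integrable_const C).indicator hAm)) (.of_forall fun ω => ?_)
      beta_reduce
      by_cases hω : ω ∈ A
      · rw [Set.indicator_of_mem hω]
        have h1 : 0 ≤ K * η := by positivity
        have := habs (hH.anchored_nonneg (1 - j) (r - j) fun l => u⁻¹ • X l ω)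
            (hH.anchored_le (by omega) (by omega) _)
            (hH.anchored_nonneg (-(k : ℤ)) k fun l => u⁻¹ • X l ω)
            (hH.anchored_le (by omega) (by omega) _)
        linarith
      · rw [Set.indicator_of_notMem hω, add_zero]
        refine hH.abs_anchored_sub_le (by omega) (by omega) hη0.le hη1 fun i hi1 hi2 hik => ?_
        rw [norm_smul, norm_inv, Real.norm_eq_abs, abs_of_pos hu, inv_mul_le_iff₀ hu]
        by_contra! hlt
        exact hω ⟨i, ⟨hik.le, abs_le.2 ⟨by omega, by omega⟩⟩, hlt⟩
  have hcard : (Finset.Icc 1 (r : ℤ)).card = r := by simp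
  have hTcard : ∑ j ∈ Finset.Icc 1 (r : ℤ), (if j ∈ T then C else 0) ≤ C * (2 * k) := by
    rw [← Finset.sum_filter, Finset.sum_const, nsmul_eq_mul, mul_comm]
    refine mul_le_mul_of_nonneg_left ?_ hC
    have h1 : ((Finset.Icc 1 (r : ℤ)).filter (· ∈ T)).card ≤ 2 * k := by
      refine (Finset.card_le_card (t := T) fun j hj => (Finset.mem_filter.1 hj).2).trans ?_
      refine (Finset.card_union_le _ _).trans ?_
      simp
      omega
    exact_mod_cast h1
  rw [hH.integral_block_eq_sum hX hstat r hu]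
  have hsub : (∑ j ∈ Finset.Icc 1 (r : ℤ), ∫ ω, anchored H (1 - j) (r - j)
      (fun l => u⁻¹ • X l ω) ∂Q) / r - b = (∑ j ∈ Finset.Icc 1 (r : ℤ),
      ((∫ ω, anchored H (1 - j) (r - j) (fun l => u⁻¹ • X l ω) ∂Q) - b)) / r := by
    rw [Finset.sum_sub_distrib, Finset.sum_const, hcard, nsmul_eq_mul, sub_div,
      mul_div_cancel_left₀ _ hrpos.ne']
  rw [hsub, abs_div, abs_of_pos hrpos, div_le_iff₀ hrpos]
  refine (Finset.abs_sum_le_sum_abs _ _).trans ((Finset.sum_le_sum hterm).trans ?_)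
  rw [Finset.sum_add_distrib, Finset.sum_const, hcard, nsmul_eq_mul, add_mul _ (_ / _),
    div_mul_cancel₀ _ hrpos.ne']
  linarith

/-- Convergence of normalized means of Lipschitz block functionals. -/
theorem IsLipschitzTest.tendsto_block [IsProbabilityMeasure P] [IsProbabilityMeasure P']
    (hX : ∀ j, Measurable (X j)) (hstat : IsStationary P X)
    (hRV : IsRegularlyVarying P X α) (hY : ∀ j, Measurable (Y j))
    (hXY : IsTailProcess P X P' Y) {r : ℕ → ℕ} {u : ℕ → ℝ} (hr : Tendsto r atTop atTop)
    (hu : Tendsto u atTop atTop) (hAC : Anticlustering P X r u)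
    (h1 : ∀ᵐ y ∂(pathLaw P' Y), 1 < ‖y 0‖)
    (h0 : ∀ᵐ y ∂(pathLaw P' Y), Tendsto y cofinite (𝓝 0)) (hH : IsLipschitzTest H K C) :
    Tendsto (fun n => (∫ ω, H (block X (r n) (u n) ω) ∂P) /
      ((r n : ℝ) * P.real {ω | u n < ‖X 0 ω‖})) atTop
      (𝓝 (∫ y in {y | IsFirstMax y 0}, H (toEllZero y) ∂(pathLaw P' Y))) := by
  have hC : 0 ≤ C := (hH.nonneg 0).trans (hH.le 0)
  rw [Metric.tendsto_atTop']
  intro δ hδ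
  -- Five errors of size δ/5: the three of `abs_sub_integral_anchored_le`, the weak limit in n, and
  -- the limit in k. The order of choice is η, then k, then n; K + 1 and C + 1 avoid division by 0.
  obtain ⟨η, hη0, hη1, hηδ⟩ : ∃ η : ℝ, 0 < η ∧ η ≤ 1 ∧ K * η < δ / 5 := by
    have hK : (0 : ℝ) ≤ K := K.2
    refine ⟨min 1 (δ / (5 * (K + 1))), by positivity, min_le_left _ _, ?_⟩
    calc (K : ℝ) * min 1 (δ / (5 * (K + 1))) ≤ K * (δ / (5 * (K + 1))) :=
          mul_le_mul_of_nonneg_left (min_le_right _ _) hK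
      _ < (K + 1) * (δ / (5 * (K + 1))) := by
          apply mul_lt_mul_of_pos_right (by linarith) (by positivity)
      _ = δ / 5 := by field_simp
  have hlimk := hH.tendsto_integral_anchored hstat hRV hY hXY h1 h0
  have hq : (0 : ℝ≥0∞) < ENNReal.ofReal (δ / (5 * (C + 1))) := ENNReal.ofReal_pos.2 (by positivity)
  obtain ⟨k, hk1, hk2⟩ := (((Metric.tendsto_nhds.1 hlimk) (δ / 5) (by positivity)).and
    ((hAC η 1 hη0 one_pos).eventually_lt_const hq)).exists
  have hlimn := (hXY.tendsto_integral (hH.continuous_anchored (a := -(k : ℤ)) (b := k) (by omega)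
    (by omega)) (hH.abs_anchored_le (by omega) (by omega)) (dependsOn_anchored H k)).comp hu
  have hpath : ∫ ω, anchored H (-(k : ℤ)) k (fun l => Y l ω) ∂P' =
      ∫ y, anchored H (-(k : ℤ)) k y ∂(pathLaw P' Y) :=
    (integral_map (measurable_path hY).aemeasurable
      (hH.continuous_anchored (by omega) (by omega)).aestronglyMeasurable).symm
  rw [hpath] at hlimn
  have hlimr : Tendsto (fun n => C * (2 * k) / (r n : ℝ)) atTop (𝓝 0) :=
    tendsto_const_nhds.div_atTop (tendsto_natCast_atTop_atTop.comp hr)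
  have hev : ∀ᶠ n in atTop, dist ((∫ ω, H (block X (r n) (u n) ω) ∂P) /
      ((r n : ℝ) * P.real {ω | u n < ‖X 0 ω‖}))
      (∫ y in {y | IsFirstMax y 0}, H (toEllZero y) ∂(pathLaw P' Y)) < δ := by
    filter_upwards [eventually_lt_of_limsup_lt hk2, (Metric.tendsto_nhds.1 hlimn) (δ / 5)
      (by positivity), hlimr.eventually_lt_const (u := δ / 5) (by positivity),
      hr.eventually_gt_atTop 0, hu.eventually_gt_atTop 0] with n hn1 hn2 hn3 hn4 hn5
    have hmain := hH.abs_sub_integral_anchored_le hX hstat hRV hn4 hn5 k hη0 hη1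
    have hprob := isProbabilityMeasure_cond_tail hRV (u n)
    simp only [mul_one, ← and_assoc] at hn1
    have hq' : C * (P[|{ω | u n < ‖X 0 ω‖}]).real
        {ω | ∃ j : ℤ, ((k : ℤ) ≤ |j| ∧ |j| ≤ (r n : ℤ)) ∧ u n * η < ‖X j ω‖} ≤ δ / 5 := by
      have h2 := (ENNReal.lt_ofReal_iff_toReal_lt (measure_ne_top _ _)).1 hn1
      calc _ ≤ (C + 1) * (δ / (5 * (C + 1))) :=
            mul_le_mul (by linarith) h2.le measureReal_nonneg (by linarith)
        _ = δ / 5 := by field_simp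
    simp only [Function.comp_apply] at hn2
    rw [← Real.dist_eq] at hmain
    have t1 := dist_triangle4 ((∫ ω, H (block X (r n) (u n) ω) ∂P) /
      ((r n : ℝ) * P.real {ω | u n < ‖X 0 ω‖}))
      (∫ ω, anchored H (-(k : ℤ)) k (fun l => (u n)⁻¹ • X l ω) ∂(P[|{ω | u n < ‖X 0 ω‖}]))
      (∫ y, anchored H (-(k : ℤ)) k y ∂(pathLaw P' Y))
      (∫ y in {y | IsFirstMax y 0}, H (toEllZero y) ∂(pathLaw P' Y))
    linarith
  obtain ⟨N, hN⟩ := eventually_atTop.1 hev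
  exact ⟨N, fun n hn => hN n hn.le⟩

end Convergence

/-! ### Lipschitz minorants. -/

section Envelope

variable {E : Type*} [NormedAddCommGroup E]

theorem shift_smul [NormedSpace ℝ E] (k : ℤ) (c : ℝ) (x : C₀(ℤ, E)) :
    shift k (c • x) = c • shift k x := by
  ext l
  simp [shift_apply]

/-- The largest `m`-Lipschitz minorant of a functional. -/
noncomputable def lowerEnvelope (m : NNReal) (H : C₀(ℤ, E) → ℝ) (x : C₀(ℤ, E)) : ℝ :=
  ⨅ y, H y + m * ‖x - y‖

variable {H : C₀(ℤ, E) → ℝ} {C : ℝ} (hC : ∀ x, |H x| ≤ C)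

include hC in
theorem neg_le_add_mul_norm (m : NNReal) (x y : C₀(ℤ, E)) : -C ≤ H y + m * ‖x - y‖ := by
  have h1 := (abs_le.1 (hC y)).1
  have h2 : 0 ≤ m * ‖x - y‖ := by positivity
  linarith

include hC in
theorem lowerEnvelope_le_add (m : NNReal) (x y : C₀(ℤ, E)) :
    lowerEnvelope m H x ≤ H y + m * ‖x - y‖ :=
  ciInf_le ⟨-C, by rintro _ ⟨z, rfl⟩; exact neg_le_add_mul_norm hC m x z⟩ y

include hC in
theorem lowerEnvelope_le (m : NNReal) (x : C₀(ℤ, E)) : lowerEnvelope m H x ≤ H x := by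
  simpa using lowerEnvelope_le_add hC m x x

include hC in
theorem abs_lowerEnvelope_le (m : NNReal) (x : C₀(ℤ, E)) : |lowerEnvelope m H x| ≤ C :=
  abs_le.2 ⟨le_ciInf fun y => neg_le_add_mul_norm hC m x y,
    (lowerEnvelope_le hC m x).trans (abs_le.1 (hC x)).2⟩

include hC in
theorem lipschitzWith_lowerEnvelope (m : NNReal) : LipschitzWith m (lowerEnvelope m H) := by
  refine LipschitzWith.of_le_add_mul m fun x x' => ?_
  rw [← sub_le_iff_le_add]
  refine le_ciInf fun y => ?_
  have h1 := lowerEnvelope_le_add hC m x y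
  have h2 : ‖x - y‖ ≤ dist x x' + ‖x' - y‖ := by
    rw [dist_eq_norm]
    exact norm_sub_le_norm_sub_add_norm_sub x x' y
  have h3 : (m : ℝ) * ‖x - y‖ ≤ m * (dist x x' + ‖x' - y‖) := mul_le_mul_of_nonneg_left h2 m.2
  rw [mul_add] at h3
  linarith

theorem lowerEnvelope_shift (hinv : ∀ (k : ℤ) (x : C₀(ℤ, E)), H (shift k x) = H x) (m : NNReal)
    (k : ℤ) (x : C₀(ℤ, E)) : lowerEnvelope m H (shift k x) = lowerEnvelope m H x := by
  -- Shifts are bijective isometries, so they only permute the competitors y in the infimum.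
  have hsurj : Function.Surjective (shift k : C₀(ℤ, E) → C₀(ℤ, E)) := fun y =>
    ⟨shift (-k) y, shift_shift_neg k y⟩
  refine (hsurj.iInf_congr _ fun y => ?_).symm
  rw [hinv, ← shift_sub, norm_shift]

include hC in
-- A competitor y with H y < 0 has norm above ε, hence lies at distance at least ε/2 from x, and its
-- penalty is at least m ε/2 ≥ C.
theorem lowerEnvelope_eq_zero {ε : ℝ} (hε : 0 < ε) (hsupp : ∀ x, ‖x‖ ≤ ε → H x = 0) {m : NNReal}
    (hm : 2 * C / ε ≤ m) {x : C₀(ℤ, E)} (hx : ‖x‖ ≤ ε / 2) : lowerEnvelope m H x = 0 := by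
  apply le_antisymm
  · exact (lowerEnvelope_le hC m x).trans (hsupp x (by linarith)).le
  · refine le_ciInf fun y => ?_
    by_cases hy : ‖y‖ ≤ ε
    · rw [hsupp y hy, zero_add]
      positivity
    · rw [div_le_iff₀ hε] at hm
      have h1 := (abs_le.1 (hC y)).1
      have h2 : ε / 2 ≤ ‖x - y‖ := by
        have := norm_sub_norm_le y x
        rw [norm_sub_rev] at this
        push Not at hy
        linarith
      have h3 : (m : ℝ) * (ε / 2) ≤ m * ‖x - y‖ := mul_le_mul_of_nonneg_left h2 m.2
      linarith

include hC in
-- Competitors within ρ of x have values close to H x; those farther away pay at least m ρ ≥ 2C, the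
-- full oscillation of H.
theorem tendsto_lowerEnvelope {x : C₀(ℤ, E)} (hx : ContinuousAt H x) :
    Tendsto (fun m : ℕ => lowerEnvelope (m : NNReal) H x) atTop (𝓝 (H x)) := by
  rw [Metric.tendsto_nhds]
  intro δ hδ
  obtain ⟨ρ, hρ, hball⟩ := Metric.continuousAt_iff.1 hx (δ / 2) (by positivity)
  filter_upwards [eventually_ge_atTop ⌈2 * C / ρ⌉₊] with m hm
  have hm' : 2 * C ≤ m * ρ := (div_le_iff₀ hρ).1 (Nat.ceil_le.1 hm)
  have hle := lowerEnvelope_le hC (m : NNReal) x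
  have hge : H x - δ / 2 ≤ lowerEnvelope (m : NNReal) H x := by
    refine le_ciInf fun y => ?_
    have hpos : 0 ≤ ((m : NNReal) : ℝ) * ‖x - y‖ := by positivity
    by_cases hy : dist y x < ρ
    · have := hball hy
      rw [Real.dist_eq] at this
      have := (abs_lt.1 this).1
      linarith
    · have h2 : ρ ≤ ‖x - y‖ := by
        rw [← dist_eq_norm, dist_comm]
        exact not_lt.1 hy
      have h3 : (m : ℝ) * ρ ≤ m * ‖x - y‖ := mul_le_mul_of_nonneg_left h2 (by positivity)
      have h4 := (abs_le.1 (hC y)).1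
      have h5 := (abs_le.1 (hC x)).2
      rw [NNReal.coe_natCast]
      linarith
  rw [Real.dist_eq, abs_lt]
  constructor <;> linarith

end Envelope

/-! ### Scaling, general functionals, and the three convergence statements. -/

section Convergence

variable {E : Type*} [NormedAddCommGroup E] [NormedSpace ℝ E] [MeasurableSpace E]
  [BorelSpace E] [SecondCountableTopology E] {Ω : Type*} [MeasurableSpace Ω] {Ω' : Type*}
  [MeasurableSpace Ω'] {P : Measure Ω} {X : ℤ → Ω → E} {P' : Measure Ω'} {Y : ℤ → Ω' → E} {α : ℝ}

omit [MeasurableSpace E] [BorelSpace E] [SecondCountableTopology E] [MeasurableSpace Ω] in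
theorem block_eq_smul_block (r : ℕ) {ε : ℝ} (hε : ε ≠ 0) (u : ℝ) (ω : Ω) :
    block X r u ω = ε • block X r (ε * u) ω := by
  ext l
  rw [ZeroAtInftyContinuousMap.smul_apply, block, block, window_apply, window_apply]
  split_ifs
  · rw [smul_smul, mul_inv, mul_inv_cancel_left₀ hε]
  · rw [smul_zero]

omit [NormedSpace ℝ E] [MeasurableSpace E] [BorelSpace E] [SecondCountableTopology E] in
theorem Anticlustering.const_mul {r : ℕ → ℕ} {u : ℕ → ℝ} (hAC : Anticlustering P X r u) {ε : ℝ}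
    (hε : 0 < ε) : Anticlustering P X r fun n => ε * u n := by
  intro x y hx hy
  have := hAC (ε * x) (ε * y) (by positivity) (by positivity)
  simpa only [mul_assoc, mul_left_comm] using this

theorem integrable_clusterMeasure [IsProbabilityMeasure P] [IsProbabilityMeasure P']
    (hstat : IsStationary P X) (hRV : IsRegularlyVarying P X α) (hY : ∀ j, Measurable (Y j))
    (hXY : IsTailProcess P X P' Y)
    (h1 : ∀ᵐ ω ∂P', 1 < ‖Y 0 ω‖) (h0 : ∀ᵐ ω ∂P', Tendsto (fun j => Y j ω) cofinite (𝓝 0))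
    {H : C₀(ℤ, E) → ℝ} (hm : Measurable H) {C : ℝ} (hC : ∀ x, |H x| ≤ C) {ε : ℝ} (hε : 0 < ε)
    (hsupp : ∀ x, ‖x‖ ≤ ε → H x = 0) : Integrable H (clusterMeasure P' Y α) := by
  rw [← integrableOn_iff_integrable_of_support_subset (s := {x | ε ≤ ‖x‖})]
  · exact Measure.integrableOn_of_bounded
      (clusterMeasure_norm_ge_lt_top hstat hRV hY hXY h1 h0 hε).ne hm.aestronglyMeasurable
      (M := C) (.of_forall hC)
  · intro x hx
    by_contra hxε
    exact hx (hsupp x (not_le.1 hxε).le)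

/-- The quantities common to the convergence statements: a stationary regularly varying time series
with its tail process, under anticlustering. -/
structure ClusterSetting (P : Measure Ω) (X : ℤ → Ω → E) (α : ℝ) (P' : Measure Ω')
    (Y : ℤ → Ω' → E) (r : ℕ → ℕ) (u : ℕ → ℝ) : Prop where
  measurable : ∀ j, Measurable (X j)
  stationary : IsStationary P X
  regularlyVarying : IsRegularlyVarying P X α
  measurable_tail : ∀ j, Measurable (Y j)
  tail : IsTailProcess P X P' Y
  tendsto_r : Tendsto r atTop atTop
  tendsto_u : Tendsto u atTop atTop
  anticlustering : Anticlustering P X r u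

variable {r : ℕ → ℕ} {u : ℕ → ℝ}

omit [SecondCountableTopology E] in
theorem ClusterSetting.ae_one_lt [IsProbabilityMeasure P] [IsProbabilityMeasure P']
    (h : ClusterSetting P X α P' Y r u) : ∀ᵐ ω ∂P', 1 < ‖Y 0 ω‖ :=
  ae_one_lt_norm (h.measurable 0) h.regularlyVarying h.measurable_tail h.tail

theorem ClusterSetting.ae_tendsto [IsProbabilityMeasure P] [IsProbabilityMeasure P']
    (h : ClusterSetting P X α P' Y r u) : ∀ᵐ ω ∂P', Tendsto (fun j => Y j ω) cofinite (𝓝 0) :=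
  ae_tendsto_zero h.measurable h.regularlyVarying h.measurable_tail h.tail h.tendsto_r
    h.tendsto_u h.anticlustering

omit [SecondCountableTopology E] in
theorem ClusterSetting.ae_one_lt_pathLaw [IsProbabilityMeasure P] [IsProbabilityMeasure P']
    (h : ClusterSetting P X α P' Y r u) : ∀ᵐ y ∂(pathLaw P' Y), 1 < ‖y 0‖ :=
  (ae_map_iff (measurable_path h.measurable_tail).aemeasurable
    (measurableSet_lt measurable_const (measurable_pi_apply 0).norm)).2 h.ae_one_lt

theorem ClusterSetting.ae_tendsto_pathLaw [IsProbabilityMeasure P] [IsProbabilityMeasure P']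
    (h : ClusterSetting P X α P' Y r u) : ∀ᵐ y ∂(pathLaw P' Y), Tendsto y cofinite (𝓝 0) :=
  (ae_map_iff (measurable_path h.measurable_tail).aemeasurable
    measurableSet_tendsto_cofinite).2 h.ae_tendsto

theorem ClusterSetting.integrable [IsProbabilityMeasure P] [IsProbabilityMeasure P']
    (h : ClusterSetting P X α P' Y r u) {H : C₀(ℤ, E) → ℝ} (hm : Measurable H) {C : ℝ}
    (hC : ∀ x, |H x| ≤ C) {ε : ℝ} (hε : 0 < ε) (hsupp : ∀ x, ‖x‖ ≤ ε → H x = 0) :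
    Integrable H (clusterMeasure P' Y α) :=
  integrable_clusterMeasure h.stationary h.regularlyVarying h.measurable_tail h.tail
    h.ae_one_lt h.ae_tendsto hm hC hε hsupp

theorem integrable_block [IsFiniteMeasure P] (hX : ∀ j, Measurable (X j)) {H : C₀(ℤ, E) → ℝ}
    (hm : Measurable H) {C : ℝ} (hC : ∀ x, |H x| ≤ C) (r : ℕ) (u : ℝ) :
    Integrable (fun ω => H (block X r u ω)) P :=
  Integrable.of_bound (hm.comp (measurable_block hX r u)).aestronglyMeasurable C
    (.of_forall fun _ => hC _)

/-- H(ε ·) vanishes on the unit ball, and the block at level u is ε times the block at level εu. The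
levels εu satisfy the same hypotheses, and the factor ε^α from homogeneity of `ν*` cancels the limit
ε^(-α) of the tail ratio. -/
theorem ClusterSetting.tendsto_block_lipschitz_nonneg [IsProbabilityMeasure P]
    [IsProbabilityMeasure P'] (h : ClusterSetting P X α P' Y r u) {H : C₀(ℤ, E) → ℝ} {K : NNReal}
    (hLip : LipschitzWith K H) {C : ℝ} (hH0 : ∀ x, 0 ≤ H x) (hC : ∀ x, H x ≤ C)
    (hinv : ∀ (k : ℤ) (x : C₀(ℤ, E)), H (shift k x) = H x) {ε : ℝ} (hε : 0 < ε)
    (hsupp : ∀ x, ‖x‖ ≤ ε → H x = 0) :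
    Tendsto (fun n => (∫ ω, H (block X (r n) (u n) ω) ∂P) /
      ((r n : ℝ) * P.real {ω | u n < ‖X 0 ω‖})) atTop
      (𝓝 (∫ x, H x ∂(clusterMeasure P' Y α))) := by
  have hm : Measurable H := hLip.continuous.measurable
  have hmε : Measurable fun x => H (ε • x) := hm.comp (measurable_const_smul_ellZero ε)
  have hzero : ∀ x : C₀(ℤ, E), ‖x‖ ≤ 1 → H (ε • x) = 0 := by
    intro x hx
    apply hsupp
    rw [norm_smul, Real.norm_eq_abs, abs_of_pos hε]
    nlinarith
  have htest : IsLipschitzTest (fun x => H (ε • x)) (K * ‖ε‖₊) C :=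
    { lipschitz := hLip.comp (lipschitzWith_smul ε)
      nonneg := fun x => hH0 _
      le := fun x => hC _
      shift_invariant := fun k x => by rw [← shift_smul, hinv]
      eq_zero := hzero }
  have hlim := htest.tendsto_block h.measurable h.stationary h.regularlyVarying h.measurable_tail
    h.tail h.tendsto_r (h.tendsto_u.const_mul_atTop hε) (h.anticlustering.const_mul hε)
    h.ae_one_lt_pathLaw h.ae_tendsto_pathLaw
  have hval : ∫ y in {y | IsFirstMax y 0}, H (ε • toEllZero y) ∂(pathLaw P' Y) =
      ε ^ α * ∫ x, H x ∂(clusterMeasure P' Y α) := by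
    rw [integral_eq_lintegral_of_nonneg_ae (.of_forall fun y => hH0 _)
        (hmε.comp measurable_toEllZero).aestronglyMeasurable,
      integral_eq_lintegral_of_nonneg_ae (.of_forall hH0) hm.aestronglyMeasurable,
      ← lintegral_clusterMeasure_of_support h.stationary h.regularlyVarying h.measurable_tail
        h.tail h.ae_one_lt h.ae_tendsto (F := fun x => ENNReal.ofReal (H (ε • x)))
        hmε.ennreal_ofReal (fun x hx => by rw [hzero x hx, ENNReal.ofReal_zero]),
      lintegral_clusterMeasure_comp_smul h.measurable_tail h.ae_one_lt h.ae_tendsto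
        (F := fun x => ENNReal.ofReal (H x)) hm.ennreal_ofReal hε, ENNReal.toReal_mul,
      ENNReal.toReal_ofReal (by positivity)]
  rw [hval] at hlim
  have hprod := ((h.regularlyVarying.tail ε hε).comp h.tendsto_u).mul hlim
  rw [← mul_assoc, ← Real.rpow_add hε, neg_add_cancel, Real.rpow_zero, one_mul] at hprod
  refine hprod.congr fun n => ?_
  have hne := (h.regularlyVarying.tail_pos (ε * u n)).ne'
  simp only [Function.comp_apply, ← block_eq_smul_block (r n) hε.ne' (u n)]
  rw [div_mul_div_comm, ← mul_assoc, mul_comm (P.real {ω | u n < ‖X 0 ω‖}) (r n : ℝ),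
    mul_comm (P.real {ω | ε * u n < ‖X 0 ω‖}), mul_div_mul_right _ _ hne]

theorem ClusterSetting.tendsto_block_lipschitz [IsProbabilityMeasure P]
    [IsProbabilityMeasure P'] (h : ClusterSetting P X α P' Y r u) {H : C₀(ℤ, E) → ℝ} {K : NNReal}
    (hLip : LipschitzWith K H) {C : ℝ} (hC : ∀ x, |H x| ≤ C)
    (hinv : ∀ (k : ℤ) (x : C₀(ℤ, E)), H (shift k x) = H x) {ε : ℝ} (hε : 0 < ε)
    (hsupp : ∀ x, ‖x‖ ≤ ε → H x = 0) :
    Tendsto (fun n => (∫ ω, H (block X (r n) (u n) ω) ∂P) /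
      ((r n : ℝ) * P.real {ω | u n < ‖X 0 ω‖})) atTop
      (𝓝 (∫ x, H x ∂(clusterMeasure P' Y α))) := by
  have hC0 : 0 ≤ C := (abs_nonneg _).trans (hC 0)
  have hLp : LipschitzWith K fun x => max (H x) 0 := hLip.max_const 0
  have hLn : LipschitzWith K fun x => max (-H x) 0 := hLip.neg.max_const 0
  have hp : ∀ x, max (H x) 0 ≤ C := fun x => max_le (abs_le.1 (hC x)).2 hC0
  have hn : ∀ x, max (-H x) 0 ≤ C := fun x => max_le (by linarith [(abs_le.1 (hC x)).1]) hC0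
  have hpz : ∀ x, ‖x‖ ≤ ε → max (H x) 0 = 0 := fun x hx => by simp [hsupp x hx]
  have hnz : ∀ x, ‖x‖ ≤ ε → max (-H x) 0 = 0 := fun x hx => by simp [hsupp x hx]
  have habs : ∀ {a : ℝ}, max a 0 ≤ C → |max a 0| ≤ C := fun {a} ha => by
    rwa [abs_of_nonneg (le_max_right a 0)]
  have hsplit : ∀ x, H x = max (H x) 0 - max (-H x) 0 := fun x => by
    rcases le_total (H x) 0 with hx | hx
    · rw [max_eq_right hx, max_eq_left (by linarith)]
      ring
    · rw [max_eq_left hx, max_eq_right (by linarith)]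
      ring
  have l1 := h.tendsto_block_lipschitz_nonneg hLp (fun x => le_max_right _ _) hp
    (fun k x => by rw [hinv]) hε hpz
  have l2 := h.tendsto_block_lipschitz_nonneg hLn (fun x => le_max_right _ _) hn
    (fun k x => by rw [hinv]) hε hnz
  have i1 : ∫ x, H x ∂(clusterMeasure P' Y α) = ∫ x, max (H x) 0 ∂(clusterMeasure P' Y α) -
      ∫ x, max (-H x) 0 ∂(clusterMeasure P' Y α) := by
    rw [← integral_sub
      (h.integrable hLp.continuous.measurable (fun x => habs (hp x)) hε hpz)
      (h.integrable hLn.continuous.measurable (fun x => habs (hn x)) hε hnz)]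
    exact integral_congr_ae (.of_forall hsplit)
  rw [i1]
  refine (l1.sub l2).congr fun n => ?_
  rw [← sub_div, ← integral_sub
    (integrable_block h.measurable hLp.continuous.measurable (fun x => habs (hp x)) _ _)
    (integrable_block h.measurable hLn.continuous.measurable (fun x => habs (hn x)) _ _)]
  simp_rw [← hsplit]

/-- Integrals of the minorants increase past δ by dominated convergence under `ν*`, almost
everywhere continuity giving the pointwise limit. One minorant, for which block convergence is
known, suffices. -/
theorem ClusterSetting.eventually_block_gt [IsProbabilityMeasure P]
    [IsProbabilityMeasure P'] (h : ClusterSetting P X α P' Y r u) {H : C₀(ℤ, E) → ℝ}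
    (hm : Measurable H) {C : ℝ} (hC : ∀ x, |H x| ≤ C)
    (hinv : ∀ (k : ℤ) (x : C₀(ℤ, E)), H (shift k x) = H x) {ε : ℝ} (hε : 0 < ε)
    (hsupp : ∀ x, ‖x‖ ≤ ε → H x = 0) (hcont : ∀ᵐ x ∂(clusterMeasure P' Y α), ContinuousAt H x)
    {δ : ℝ} (hδ : δ < ∫ x, H x ∂(clusterMeasure P' Y α)) :
    ∀ᶠ n in atTop, δ < (∫ ω, H (block X (r n) (u n) ω) ∂P) /
      ((r n : ℝ) * P.real {ω | u n < ‖X 0 ω‖}) := by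
  have hmeas : ∀ m : NNReal, Measurable (lowerEnvelope m H) := fun m =>
    (lipschitzWith_lowerEnvelope hC m).continuous.measurable
  have hlarge : ∀ᶠ m : ℕ in atTop, 2 * C / ε ≤ ((m : NNReal) : ℝ) := by
    filter_upwards [eventually_ge_atTop ⌈2 * C / ε⌉₊] with m hm
    rw [NNReal.coe_natCast]
    exact Nat.ceil_le.1 hm
  have hC0 : 0 ≤ C := (abs_nonneg _).trans (hC 0)
  have hlim : Tendsto (fun m : ℕ => ∫ x, lowerEnvelope (m : NNReal) H x ∂(clusterMeasure P' Y α))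
      atTop (𝓝 (∫ x, H x ∂(clusterMeasure P' Y α))) := by
    have hSm : MeasurableSet {x : C₀(ℤ, E) | ε / 2 < ‖x‖} :=
      measurableSet_lt measurable_const continuous_norm.measurable
    -- `ν*` may be infinite; the dominating function lives on ‖x‖ > ε/2, which has finite mass and
    -- outside which the minorants vanish for large m.
    refine tendsto_integral_filter_of_dominated_convergence
      ({x : C₀(ℤ, E) | ε / 2 < ‖x‖}.indicator fun _ => C)
      (.of_forall fun m => (hmeas _).aestronglyMeasurable) ?_ ?_ ?_
    · filter_upwards [hlarge] with m hmC
      refine .of_forall fun x => ?_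
      by_cases hx : ε / 2 < ‖x‖
      · rw [Set.indicator_of_mem (s := {x : C₀(ℤ, E) | ε / 2 < ‖x‖}) hx]
        exact abs_lowerEnvelope_le hC _ x
      · rw [Set.indicator_of_notMem (s := {x : C₀(ℤ, E) | ε / 2 < ‖x‖}) hx,
          lowerEnvelope_eq_zero hC hε hsupp hmC (not_lt.1 hx), norm_zero]
    · refine h.integrable (measurable_const.indicator hSm) (C := C) (fun x => ?_) (half_pos hε)
        fun x hx => Set.indicator_of_notMem (s := {x : C₀(ℤ, E) | ε / 2 < ‖x‖}) (not_lt.2 hx) _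
      rw [Set.indicator_apply]
      split_ifs
      · exact (abs_of_nonneg hC0).le
      · simpa using hC0
    · filter_upwards [hcont] with x hx
      exact tendsto_lowerEnvelope hC hx
  obtain ⟨m, hm1, hm2⟩ := ((hlim.eventually_const_lt hδ).and hlarge).exists
  have hblock := h.tendsto_block_lipschitz (lipschitzWith_lowerEnvelope hC (m : NNReal))
    (abs_lowerEnvelope_le hC _) (lowerEnvelope_shift hinv _) (half_pos hε)
    fun x hx => lowerEnvelope_eq_zero hC hε hsupp hm2 hx
  filter_upwards [hblock.eventually_const_lt hm1] with n hn
  refine hn.trans_le (div_le_div_of_nonneg_right ?_ (by positivity))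
  exact integral_mono
    (integrable_block h.measurable (hmeas _) (abs_lowerEnvelope_le hC _) _ _)
    (integrable_block h.measurable hm hC _ _) fun ω => lowerEnvelope_le hC _ _

/-- Convergence of normalized means of block functionals in the class `𝒜`. -/
theorem ClusterSetting.tendsto_block [IsProbabilityMeasure P]
    [IsProbabilityMeasure P'] (h : ClusterSetting P X α P' Y r u) {H : C₀(ℤ, E) → ℝ}
    (hH : ClassA (clusterMeasure P' Y α) H) :
    Tendsto (fun n => (∫ ω, H (block X (r n) (u n) ω) ∂P) /
      ((r n : ℝ) * P.real {ω | u n < ‖X 0 ω‖})) atTop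
      (𝓝 (∫ x, H x ∂(clusterMeasure P' Y α))) := by
  obtain ⟨C, hC⟩ := hH.bounded
  obtain ⟨ε, hε, hsupp⟩ := hH.support_separated
  rcases hH.regular with ⟨K, hK⟩ | hcont
  · exact h.tendsto_block_lipschitz hK hC hH.shift_invariant hε hsupp
  · refine tendsto_order.2 ⟨fun δ hδ => h.eventually_block_gt hH.measurable hC hH.shift_invariant
      hε hsupp hcont hδ, fun δ hδ => ?_⟩
    have hneg := h.eventually_block_gt (H := fun x => -H x) (C := C) hH.measurable.neg
      (fun x => by rw [abs_neg]; exact hC x) (fun k x => by rw [hH.shift_invariant]) hε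
      (fun x hx => by rw [hsupp x hx, neg_zero]) (hcont.mono fun x hx => hx.neg) (δ := -δ)
      (by rw [integral_neg]; linarith)
    filter_upwards [hneg] with n hn
    rw [integral_neg, neg_div] at hn
    linarith

theorem integral_blockMeasure (hX : ∀ j, Measurable (X j)) {H : C₀(ℤ, E) → ℝ} (hm : Measurable H)
    (r : ℕ) (u : ℝ) : ∫ x, H x ∂(blockMeasure P X r u) =
      (∫ ω, H (block X r u ω) ∂P) / ((r : ℝ) * P.real {ω | u < ‖X 0 ω‖}) := by
  rw [blockMeasure, integral_smul_measure,
    integral_map (measurable_block hX r u).aemeasurable hm.aestronglyMeasurable,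
    ENNReal.toReal_inv, ENNReal.toReal_mul, ENNReal.toReal_natCast, smul_eq_mul, inv_mul_eq_div,
    measureReal_def]

theorem ClusterSetting.tendsto_blockMeasure [IsProbabilityMeasure P]
    [IsProbabilityMeasure P'] (h : ClusterSetting P X α P' Y r u) {H : C₀(ℤ, E) → ℝ}
    (hH : ClassA (clusterMeasure P' Y α) H) :
    Tendsto (fun n => ∫ x, H x ∂(blockMeasure P X (r n) (u n))) atTop
      (𝓝 (∫ x, H x ∂(clusterMeasure P' Y α))) := by
  simp_rw [integral_blockMeasure h.measurable hH.measurable]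
  exact h.tendsto_block hH

theorem ClusterSetting.vagueSharpTendsto [IsProbabilityMeasure P]
    [IsProbabilityMeasure P'] (h : ClusterSetting P X α P' Y r u) :
    VagueSharpTendsto (fun n => (blockMeasure P X (r n) (u n)).map shiftClass)
      ((clusterMeasure P' Y α).map shiftClass) := by
  intro f hf
  have hcont : Continuous (shiftClass : C₀(ℤ, E) → ShiftQuotient E) := continuous_quot_mk
  have hmeas : Measurable (shiftClass : C₀(ℤ, E) → ShiftQuotient E) := measurable_quotient_mk''
  have hcomp : Continuous fun x : C₀(ℤ, E) => f (shiftClass x) := f.continuous.comp hcont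
  -- With the quotient σ-algebra, measurability is tested on the pullback to `ℓ₀`.
  have hfm : Measurable f := measurable_from_quotient.2 hcomp.measurable
  have hmap : ∀ μ : Measure C₀(ℤ, E), ∫ q, f q ∂(μ.map shiftClass) = ∫ x, f (shiftClass x) ∂μ :=
    fun μ => integral_map hmeas.aemeasurable hfm.aestronglyMeasurable
  simp_rw [hmap]
  refine h.tendsto_blockMeasure
    { measurable := hcomp.measurable
      bounded := ⟨‖f‖, fun x => f.norm_coe_le_norm _⟩
      shift_invariant := fun k x => congrArg f (Quotient.sound (s := shiftSetoid E)
        ((shiftSetoid E).symm ⟨k, rfl⟩))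
      support_separated := ?_
      regular := Or.inr (.of_forall fun x => hcomp.continuousAt) }
  have hev := hcont.continuousAt.eventually hf
  obtain ⟨ρ, hρ, hball⟩ := Metric.eventually_nhds_iff.1 hev
  -- Half the radius, since vanishing is required on a closed ball.
  refine ⟨ρ / 2, half_pos hρ, fun x hx => hball ?_⟩
  rw [dist_zero_right]
  linarith

theorem ClusterSetting.classA_indicator [IsProbabilityMeasure P]
    [IsProbabilityMeasure P'] (h : ClusterSetting P X α P' Y r u) :
    ClassA (clusterMeasure P' Y α) ({x : C₀(ℤ, E) | 1 < ‖x‖}.indicator 1) where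
  measurable := measurable_one.indicator
    (measurableSet_lt measurable_const continuous_norm.measurable)
  bounded := ⟨1, fun x => by
    rw [Set.indicator_apply]
    split_ifs <;> simp⟩
  shift_invariant k x := by
    simp only [Set.indicator_apply, Set.mem_ofPred_eq, norm_shift, Pi.one_apply]
  support_separated := ⟨1, one_pos, fun x hx =>
    Set.indicator_of_notMem (s := {x : C₀(ℤ, E) | 1 < ‖x‖}) (not_lt.2 hx) _⟩
  regular := by
    right
    have hnull := measure_eq_zero_iff_ae_notMem.1
      (clusterMeasure_norm_eq_one (α := α) h.measurable_tail h.ae_one_lt h.ae_tendsto)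
    filter_upwards [hnull] with x hx
    rcases lt_or_gt_of_ne (show ‖x‖ ≠ 1 from hx) with hlt | hgt
    · refine (continuousAt_const (y := (0 : ℝ))).congr ?_
      filter_upwards [continuous_norm.continuousAt.eventually_lt_const hlt] with z hz
      exact (Set.indicator_of_notMem (s := {x : C₀(ℤ, E) | 1 < ‖x‖}) (not_lt.2 hz.le) _).symm
    · refine (continuousAt_const (y := (1 : ℝ))).congr ?_
      filter_upwards [continuous_norm.continuousAt.eventually_const_lt hgt] with z hz
      exact (Set.indicator_of_mem (s := {x : C₀(ℤ, E) | 1 < ‖x‖}) hz 1).symm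

/-- When the first maximum of `Y` is at 0, the norm of the path is |Y_0|, which exceeds 1 almost
surely. -/
theorem ClusterSetting.clusterMeasure_real_one_lt_norm [IsProbabilityMeasure P]
    [IsProbabilityMeasure P'] (h : ClusterSetting P X α P' Y r u) :
    (clusterMeasure P' Y α).real {x | 1 < ‖x‖} = candidateExtremalIndex P' Y := by
  have hm : MeasurableSet {x : C₀(ℤ, E) | 1 < ‖x‖} :=
    measurableSet_lt measurable_const continuous_norm.measurable
  have e1 : clusterMeasure P' Y α {x | 1 < ‖x‖} = pathLaw P' Y {y | IsFirstMax y 0} := by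
    rw [← lintegral_indicator_one hm, lintegral_clusterMeasure_of_support h.stationary
      h.regularlyVarying h.measurable_tail h.tail h.ae_one_lt h.ae_tendsto
      (measurable_one.indicator hm) fun x hx =>
        Set.indicator_of_notMem (s := {x : C₀(ℤ, E) | 1 < ‖x‖}) (not_lt.2 hx) _,
      ← setLIntegral_one]
    refine setLIntegral_congr_fun_ae (measurableSet_isFirstMax 0) ?_
    filter_upwards [h.ae_one_lt_pathLaw, h.ae_tendsto_pathLaw] with y hy1 hy0 hD
    refine Set.indicator_of_mem (s := {x : C₀(ℤ, E) | 1 < ‖x‖}) ?_ _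
    change 1 < ‖toEllZero y‖
    rwa [norm_toEllZero_of_isFirstMax hy0 hD]
  rw [candidateExtremalIndex, measureReal_def, measureReal_def, e1, pathLaw,
    Measure.map_apply (measurable_path h.measurable_tail) (measurableSet_isFirstMax 0)]
  congr 1
  refine measure_congr ?_
  filter_upwards [h.ae_one_lt, h.ae_tendsto] with ω hω1 hω0
  exact propext (infArgmax_eq_zero_iff_of_norm (y := fun j => Y j ω) hω1 hω0).symm

omit [MeasurableSpace E] [BorelSpace E] [SecondCountableTopology E] [MeasurableSpace Ω] in
theorem one_lt_norm_block_iff (r : ℕ) {u : ℝ} (hu : 0 < u) (ω : Ω) :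
    1 < ‖block X r u ω‖ ↔ ∃ j : ℤ, 1 ≤ j ∧ j ≤ (r : ℤ) ∧ u < ‖X j ω‖ := by
  rw [lt_norm_iff zero_le_one]
  refine exists_congr fun j => ?_
  rw [block, window_apply]
  split_ifs with hj
  · rw [norm_smul, norm_inv, Real.norm_eq_abs, abs_of_pos hu, inv_mul_eq_div, one_lt_div hu]
    tauto
  · simp only [norm_zero]
    constructor
    · intro h
      linarith
    · tauto

theorem ClusterSetting.tendsto_extremalIndex [IsProbabilityMeasure P]
    [IsProbabilityMeasure P'] (h : ClusterSetting P X α P' Y r u) :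
    Tendsto (fun n => P.real {ω | ∃ j : ℤ, 1 ≤ j ∧ j ≤ (r n : ℤ) ∧ u n < ‖X j ω‖} /
      ((r n : ℝ) * P.real {ω | u n < ‖X 0 ω‖})) atTop (𝓝 (candidateExtremalIndex P' Y)) := by
  have hm : MeasurableSet {x : C₀(ℤ, E) | 1 < ‖x‖} :=
    measurableSet_lt measurable_const continuous_norm.measurable
  have hlim := h.tendsto_block h.classA_indicator
  rw [integral_indicator_one hm, h.clusterMeasure_real_one_lt_norm] at hlim
  refine hlim.congr' ?_
  filter_upwards [h.tendsto_u.eventually_gt_atTop 0] with n hn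
  congr 1
  have hpre : block X (r n) (u n) ⁻¹' {x | 1 < ‖x‖} =
      {ω | ∃ j : ℤ, 1 ≤ j ∧ j ≤ (r n : ℤ) ∧ u n < ‖X j ω‖} := by
    ext ω
    exact one_lt_norm_block_iff (r n) hn ω
  rw [← hpre, ← integral_indicator_one (measurable_block h.measurable _ _ hm)]
  rfl

end Convergence

end ClusterRV

theorem mainTheorem5
    {E : Type*} [NormedAddCommGroup E] [NormedSpace ℝ E] [FiniteDimensional ℝ E]
    [MeasurableSpace E] [BorelSpace E]
    {Ω : Type*} [MeasurableSpace Ω] (P : Measure Ω) [IsProbabilityMeasure P]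
    (X : ℤ → Ω → E) (hX : ∀ j, Measurable (X j))
    (hstat : ClusterRV.IsStationary P X)
    (α : ℝ) (hRV : ClusterRV.IsRegularlyVarying P X α)
    {Ω' : Type*} [MeasurableSpace Ω'] (P' : Measure Ω') [IsProbabilityMeasure P']
    (Y : ℤ → Ω' → E) (hY : ∀ j, Measurable (Y j))
    (hXY : ClusterRV.IsTailProcess P X P' Y)
    (r : ℕ → ℕ) (u : ℕ → ℝ)
    (hr : Tendsto r atTop atTop) (hu : Tendsto u atTop atTop)
    (hAC : ClusterRV.Anticlustering P X r u) :
    -- the tail process lies in `ℓ₀`, and the cluster measure is finite away from zero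
    (∀ᵐ ω ∂P', Tendsto (fun j => Y j ω) cofinite (𝓝 0)) ∧
    (∀ ε : ℝ, 0 < ε → ClusterRV.clusterMeasure P' Y α {x : C₀(ℤ, E) | ε ≤ ‖x‖} < ∞) ∧
    -- convergence on the shift quotient
    ClusterRV.VagueSharpTendsto
      (fun n => (ClusterRV.blockMeasure P X (r n) (u n)).map ClusterRV.shiftClass)
      ((ClusterRV.clusterMeasure P' Y α).map ClusterRV.shiftClass) ∧
    -- convergence for every functional of the class `𝒜`
    (∀ H : C₀(ℤ, E) → ℝ, ClusterRV.ClassA (ClusterRV.clusterMeasure P' Y α) H →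
      Tendsto (fun n => ∫ x, H x ∂(ClusterRV.blockMeasure P X (r n) (u n)))
        atTop (𝓝 (∫ x, H x ∂(ClusterRV.clusterMeasure P' Y α))) ∧
      Tendsto (fun n => (∫ ω, H (ClusterRV.block X (r n) (u n) ω) ∂P) /
          ((r n : ℝ) * P.real {ω | u n < ‖X 0 ω‖}))
        atTop (𝓝 (∫ x, H x ∂(ClusterRV.clusterMeasure P' Y α)))) ∧
    -- convergence to the candidate extremal index
    Tendsto (fun n => P.real {ω | ∃ j : ℤ, 1 ≤ j ∧ j ≤ (r n : ℤ) ∧ u n < ‖X j ω‖} /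
        ((r n : ℝ) * P.real {ω | u n < ‖X 0 ω‖}))
      atTop (𝓝 (ClusterRV.candidateExtremalIndex P' Y)) := by
  -- Finite dimension enters through second countability of `E`.
  have : ProperSpace E := FiniteDimensional.proper ℝ E
  have h : ClusterRV.ClusterSetting P X α P' Y r u :=
    ⟨hX, hstat, hRV, hY, hXY, hr, hu, hAC⟩
  exact ⟨h.ae_tendsto,
    fun ε hε => ClusterRV.clusterMeasure_norm_ge_lt_top hstat hRV hY hXY h.ae_one_lt h.ae_tendsto hε,
    h.vagueSharpTendsto, fun H hH => ⟨h.tendsto_blockMeasure hH, h.tendsto_block hH⟩,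
    h.tendsto_extremalIndex⟩
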